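/- Let $\mu>0$, $W>0$, $\delta>0$, and let $t^\pm_n := W \pm (-1)^n\delta$ for $n\in\mathbb Z$. Let $t=(t_n)_{n\in\mathbb Z}$ be a real sequence which is homoclinic ($|t_n-t_n^+|\to 0$ as $n\to-\infty$ and as $n\to+\infty$) or heteroclinic ($|t_n-t_n^-|\to0$ as $n\to-\infty$ and $|t_n-t_n^+|\to0$ as $n\to+\infty$), and assume that $t_n\ge\tau$ for all $n$, for some $\tau>0$. For a bounded real sequence $a$, let the corresponding capital letter $A$ denote the bounded self-adjoint operator on $\ell^2(\mathbb Z,\mathbb C)$ with matrix entries $A_{n,n+1}=A_{n+1,n}=a_n$ and $A_{i,j}=0$ if $|i-j|\ne1$. Let $A_-=-A\,\mathbf 1(A<0)$ be the negative part of $A$, and let $\Gamma_t:=\mathbf 1(T<0)$ be the spectral projector. For $h\in\ell^1(\mathbb Z,\mathbb R)$ with $(T+H)_--T_-$ trace class, put $$\mathcal F_t(h):=\frac\mu2\sum_{n\in\mathbb Z}(h_n+2t_n-2)h_n-2\,\mathrm{Tr}\big((T+H)_--T_-\big).$$ Call a positively oriented (simple closed piecewise $C^1$) contour $\mathscr C\subset\mathbb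 C$ and a number $\eta>0$ adapted to $t$ if there is $C\ge0$ such that, for all real sequences $h$ with $\|h\|_{\ell^\infty}\le\eta$ and all $z\in\mathscr C$, the operator $z-(T+H)$ is invertible with $\|(z-(T+H))^{-1}\|_{\rm op}\le C$, and moreover $-(T+H)_-=\frac1{2i\pi}\oint_{\mathscr C}\frac{z}{z-(T+H)}\,dz$. Then there exist $\mathscr C$ and $\eta$ adapted to $t$, and for every such pair $(\mathscr C,\eta)$ the following holds. 1. For all $h\in\ell^1(\mathbb Z,\mathbb R)$ with $\|h\|_{\ell^1}\le\eta$, the operator $(T+H)_--T_-$ is trace class. The map $\mathcal F_t$ is $C^\infty$ on $\{h:\|h\|_{\ell^1}\le\eta\}$, and real analytic on $\{h:\|h\|_{\ell^1}<\eta\}$. 2. For $h\in\ell^1(\mathbb Z,\mathbb R)$ the operator $\Gamma_tH$ is trace class. The formula $$L_t(h)=\mu\sum_{n\in\mathbb Z}(t_n-1)h_n+2\,\mathrm{Tr}(\Gamma_tH)$$ defines a continuous (real-valued) linear form on $\ell^1(\mathbb Z,\mathbb R)$, which is the differential of $\mathcal F_t$ at $0$. 3. For $h,k\in\ell^1(\mathbb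 Z,\mathbb R)$ the operator $\frac1{2i\pi}\oint_{\mathscr C}H\frac1{z-T}K\frac1{z-T}\,dz$ is trace class. The formula $$H_t(h,k)=\mu\sum_{n\in\mathbb Z}h_nk_n+2\,\mathrm{Tr}\Big(\frac1{2i\pi}\oint_{\mathscr C}H\frac1{z-T}K\frac1{z-T}\,dz\Big)$$ defines a continuous (real-valued) bilinear form on $\ell^1(\mathbb Z,\mathbb R)$, which is the second derivative (Hessian) of $\mathcal F_t$ at $0$. 4. There is $C\ge0$ such that, for all $h\in\ell^1(\mathbb Z,\mathbb R)$ with $\|h\|_{\ell^1}<\eta$, $$\Big|\mathcal F_t(h)-L_t(h)-\tfrac12H_t(h,h)\Big|\le C\,\|h\|_{\ell^2}^3.$$ 5. $H_t$ extends to a continuous bilinear form on $\ell^2(\mathbb Z,\mathbb R)$. -/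

import Mathlib

open scoped ENNReal ContDiff

noncomputable section

namespace SSH

/-- The Hilbert space `ℓ²(ℤ, ℂ)`. -/
abbrev Hil : Type := lp (fun _ : ℤ => ℂ) 2

/-- The Banach space `ℓ¹(ℤ, ℝ)`. -/
abbrev L1 : Type := lp (fun _ : ℤ => ℝ) 1

/-- The Hilbert space `ℓ²(ℤ, ℝ)`. -/
abbrev L2 : Type := lp (fun _ : ℤ => ℝ) 2

/-- The inclusion `ℓ¹(ℤ, ℝ) ⊆ ℓ²(ℤ, ℝ)`. -/
def toL2 (h : L1) : L2 :=
  ⟨fun n => h n, (lp.memℓp h).of_exponent_ge (by norm_num)⟩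

/-! ### Hopping operators -/

theorem memℓp_mul_shift {a : ℤ → ℝ} {M : ℝ} (hM : ∀ n, |a n| ≤ M) (k : ℤ) (ψ : Hil) :
    Memℓp (fun n : ℤ => (a n : ℂ) * ψ (n + k)) 2 := by
  have h0 : (0 : ℝ) < (2 : ℝ≥0∞).toReal := by norm_num
  have h1 : Summable fun n : ℤ => ‖ψ (n + k)‖ ^ (2 : ℝ≥0∞).toReal :=
    ((lp.memℓp ψ).summable h0).comp_injective (add_left_injective k)
  refine memℓp_gen (Summable.of_nonneg_of_le (fun n => by positivity) (fun n => ?_)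
    (h1.mul_left (M ^ (2 : ℝ≥0∞).toReal)))
  rw [norm_mul, Real.mul_rpow (norm_nonneg _) (norm_nonneg _), Complex.norm_real,
    Real.norm_eq_abs]
  have := hM n
  gcongr

/-- For a sequence `a` bounded by `M`, the operator `ψ ↦ (n ↦ a n * ψ (n + k))` on `ℓ²(ℤ, ℂ)`. -/
def mulShift (a : ℤ → ℝ) (M : ℝ) (hM : ∀ n, |a n| ≤ M) (k : ℤ) : Hil →L[ℂ] Hil :=
  LinearMap.mkContinuous
    { toFun := fun ψ => ⟨fun n : ℤ => (a n : ℂ) * ψ (n + k), memℓp_mul_shift hM k ψ⟩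
      map_add' := fun ψ φ => by
        ext n
        exact mul_add (a n : ℂ) (ψ (n + k)) (φ (n + k))
      map_smul' := fun c ψ => by
        ext n
        exact mul_left_comm (a n : ℂ) c (ψ (n + k)) }
    M
    (fun ψ => by
      have h0 : (0 : ℝ) < (2 : ℝ≥0∞).toReal := by norm_num
      have hM0 : 0 ≤ M := (abs_nonneg _).trans (hM 0)
      refine lp.norm_le_of_tsum_le h0 (by positivity) ?_
      have h1 : Summable fun n : ℤ => ‖ψ n‖ ^ (2 : ℝ≥0∞).toReal := (lp.memℓp ψ).summable h0
      have h2 : Summable fun n : ℤ => ‖ψ (n + k)‖ ^ (2 : ℝ≥0∞).toReal :=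
        h1.comp_injective (add_left_injective k)
      have h3 : ∀ n : ℤ, ‖(a n : ℂ) * ψ (n + k)‖ ^ (2 : ℝ≥0∞).toReal ≤
          M ^ (2 : ℝ≥0∞).toReal * ‖ψ (n + k)‖ ^ (2 : ℝ≥0∞).toReal := fun n => by
        rw [norm_mul, Real.mul_rpow (norm_nonneg _) (norm_nonneg _), Complex.norm_real,
          Real.norm_eq_abs]
        have := hM n
        gcongr
      calc ∑' n : ℤ, ‖(a n : ℂ) * ψ (n + k)‖ ^ (2 : ℝ≥0∞).toReal
          ≤ ∑' n : ℤ, M ^ (2 : ℝ≥0∞).toReal * ‖ψ (n + k)‖ ^ (2 : ℝ≥0∞).toReal :=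
            (Summable.of_nonneg_of_le (fun n => by positivity) h3
              (h2.mul_left _)).tsum_le_tsum h3 (h2.mul_left _)
        _ = M ^ (2 : ℝ≥0∞).toReal * ∑' n : ℤ, ‖ψ (n + k)‖ ^ (2 : ℝ≥0∞).toReal := tsum_mul_left
        _ = M ^ (2 : ℝ≥0∞).toReal * ∑' n : ℤ, ‖ψ n‖ ^ (2 : ℝ≥0∞).toReal := by
            congr 1
            exact (Equiv.addRight k).tsum_eq fun n : ℤ => ‖ψ n‖ ^ (2 : ℝ≥0∞).toReal
        _ = (M * ‖ψ‖) ^ (2 : ℝ≥0∞).toReal := by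
            rw [Real.mul_rpow hM0 (norm_nonneg _), lp.norm_rpow_eq_tsum h0])

open Classical in
/-- The operator on `ℓ²(ℤ, ℂ)` attached to a bounded real sequence `a`: its matrix in the canonical
basis has the entries `A (n, n+1) = A (n+1, n) = a n` and `0` elsewhere, that is,
`(A ψ) n = a n * ψ (n + 1) + a (n - 1) * ψ (n - 1)` (see `hop_apply`).
For unbounded sequences the value is `0`. -/
def hop (a : ℤ → ℝ) : Hil →L[ℂ] Hil :=
  if h : ∃ M : ℝ, ∀ n, |a n| ≤ M then
    mulShift a h.choose h.choose_spec 1 +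
      mulShift (fun n => a (n - 1)) h.choose (fun n => h.choose_spec (n - 1)) (-1)
  else 0

theorem hop_apply {a : ℤ → ℝ} (h : ∃ M : ℝ, ∀ n, |a n| ≤ M) (ψ : Hil) (n : ℤ) :
    hop a ψ n = (a n : ℂ) * ψ (n + 1) + (a (n - 1) : ℂ) * ψ (n - 1) := by
  rw [hop, dif_pos h]
  rfl

/-! ### Operators on a Hilbert space -/

section Operators

variable {E : Type*} [NormedAddCommGroup E] [InnerProductSpace ℂ E] [CompleteSpace E]

/-- The negative part `A_-` of a self-adjoint operator `A`, given by the functional calculus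
with the function `x ↦ max (-x) 0`. -/
def negPart (A : E →L[ℂ] E) : E →L[ℂ] E := A⁻

/-- The absolute value `|A| = (A* A)^{1/2}`. -/
def absOp (A : E →L[ℂ] E) : E →L[ℂ] E := CFC.abs A

/-- The spectral projector `𝟙(A < 0)` of a self-adjoint operator `A`: the orthogonal projection
onto the closure of the range of `A_-`, i.e. onto `(ker A_-)ᗮ`. -/
def negProj (A : E →L[ℂ] E) : E →L[ℂ] E :=
  (LinearMap.ker (negPart A).toLinearMap)ᗮ.starProjection

end Operators

/-! ### Trace -/

/-- The canonical basis of `ℓ²(ℤ, ℂ)`. -/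
def e (n : ℤ) : Hil := lp.single 2 n (1 : ℂ)

/-- `A` is trace class: `Tr |A| < ∞`. -/
def IsTraceClass (A : Hil →L[ℂ] Hil) : Prop :=
  Summable fun n : ℤ => (inner ℂ (e n) (absOp A (e n))).re

/-- The trace (of a trace class operator). -/
def trace (A : Hil →L[ℂ] Hil) : ℂ :=
  ∑' n : ℤ, inner ℂ (e n) (A (e n))

/-! ### Configurations -/

/-- The dimerized configuration `t⁺`. -/
def tPlus (W δ : ℝ) (n : ℤ) : ℝ := W + (-1) ^ n * δ

/-- The dimerized configuration `t⁻`. -/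
def tMinus (W δ : ℝ) (n : ℤ) : ℝ := W - (-1) ^ n * δ

def IsHomoclinic (W δ : ℝ) (t : ℤ → ℝ) : Prop :=
  Filter.Tendsto (fun n => |t n - tPlus W δ n|) Filter.atBot (nhds 0) ∧
    Filter.Tendsto (fun n => |t n - tPlus W δ n|) Filter.atTop (nhds 0)

def IsHeteroclinic (W δ : ℝ) (t : ℤ → ℝ) : Prop :=
  Filter.Tendsto (fun n => |t n - tMinus W δ n|) Filter.atBot (nhds 0) ∧
    Filter.Tendsto (fun n => |t n - tPlus W δ n|) Filter.atTop (nhds 0)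

/-- The energy difference
`F_t(h) = (μ/2) ∑ (h_n + 2 t_n - 2) h_n - 2 Tr ((T + H)_- - T_-)`.
The operator in the trace is self-adjoint, so that its trace is real. -/
def energyDiff (μ : ℝ) (t : ℤ → ℝ) (h : L1) : ℝ :=
  μ / 2 * ∑' n : ℤ, (h n + 2 * t n - 2) * h n -
    2 * (trace (negPart (hop t + hop h) - negPart (hop t))).re

/-! ### Contours -/

/-- `∮ f(z) dz` along the curve `γ : [0, 1] → ℂ`. -/
def curveInt {V : Type*} [NormedAddCommGroup V] [NormedSpace ℂ V] (γ : ℝ → ℂ) (f : ℂ → V) : V :=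
  ∫ s in (0 : ℝ)..1, deriv γ s • f (γ s)

/-- `(2 i π)⁻¹ ∮ f(z) dz`. -/
def cauchyInt {V : Type*} [NormedAddCommGroup V] [NormedSpace ℂ V] (γ : ℝ → ℂ) (f : ℂ → V) : V :=
  (2 * (Real.pi : ℂ) * Complex.I)⁻¹ • curveInt γ f

/-- A positively oriented contour: a simple closed piecewise `C¹` curve, parametrized by `[0, 1]`,
which winds once counterclockwise around each point it encloses. -/
structure Contour where
  toFun : ℝ → ℂ
  closed : toFun 0 = toFun 1
  piecewise_C1 : ∃ S : Finset ℝ, (S : Set ℝ) ⊆ Set.Icc 0 1 ∧ (0 : ℝ) ∈ S ∧ (1 : ℝ) ∈ S ∧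
    ∀ a ∈ S, ∀ b ∈ S, a < b → Disjoint (Set.Ioo a b) (S : Set ℝ) →
      ContDiffOn ℝ 1 toFun (Set.Icc a b)
  simple : Set.InjOn toFun (Set.Ico 0 1)
  positive : ∀ w : ℂ, w ∉ toFun '' Set.Icc 0 1 →
    cauchyInt toFun (fun z => (z - w)⁻¹) = 0 ∨ cauchyInt toFun (fun z => (z - w)⁻¹) = 1

/-- The set of points of a contour. -/
def Contour.points (γ : Contour) : Set ℂ := γ.toFun '' Set.Icc 0 1

/-- The contour `γ` and the radius `η > 0` are adapted to the configuration `t`: for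
`‖h‖_∞ ≤ η` and `z ∈ γ`, the operator `z - (T + H)` is invertible with an inverse that is bounded
uniformly in `h` and `z`, and `-(T + H)_- = (2 i π)⁻¹ ∮ z (z - (T + H))⁻¹ dz`. -/
def IsAdapted (t : ℤ → ℝ) (γ : Contour) (η : ℝ) : Prop :=
  0 < η ∧ ∃ C : ℝ, 0 ≤ C ∧ ∀ h : ℤ → ℝ, (∀ n, |h n| ≤ η) →
    (∀ z ∈ γ.points, z ∈ resolventSet ℂ (hop t + hop h) ∧
      ‖resolvent (hop t + hop h) z‖ ≤ C) ∧
    -negPart (hop t + hop h) = cauchyInt γ.toFun (fun z => z • resolvent (hop t + hop h) z)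

/-- The operator `(2 i π)⁻¹ ∮ H (z - T)⁻¹ K (z - T)⁻¹ dz`. -/
def hessOp (t : ℤ → ℝ) (γ : Contour) (h k : L1) : Hil →L[ℂ] Hil :=
  cauchyInt γ.toFun fun z => hop h * resolvent (hop t) z * hop k * resolvent (hop t) z

end SSH

end

/-!
For `h ∈ ℓ¹` the operator `H` is trace class, and for `h ∈ ℓ²` it is Hilbert–Schmidt. By the
resolvent identity,
`(T + H)_- - T_- = -(2 i π)⁻¹ ∮ z (z - T)⁻¹ H (z - T - H)⁻¹ dz`,
whose trace is analytic in `h ∈ ℓ¹`. Expanding `(z - T - H)⁻¹` to second order gives the derivatives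
at `0` and a remainder with three factors `H`, bounded by the cube of the `ℓ²` norm.

Integration by parts along the contour turns the first-order term into `Tr (P H)`, where `P` is the
Riesz projector `(2 i π)⁻¹ ∮ (z - T)⁻¹ dz`. Adaptedness only gives `P T = -T_-`, so `P` and
`𝟙(T < 0)` may differ on `ker T`. Their difference vanishes on the range of `T` and is scalar on
`ker T`, hence commutes with the reflection across the even sublattice, with which `H` anticommutes:
its product with `H` has trace zero.

An adapted contour exists because `T` exchanges the even and odd sublattices: a lower bound
`c ‖f‖ ≤ ‖T f‖` on one of them excludes `(-c, c) \ {0}` from the spectrum. The equation `T f = g` on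
the even sublattice is a two-term recurrence whose ratio is bounded away from `1` near `±∞`, and
solving it in the stable direction gives the lower bound, which persists for small perturbations.
-/

noncomputable section

namespace SSH

/-! ### The canonical basis of `ℓ²(ℤ, ℂ)` -/

theorem inner_e_left (n : ℤ) (ψ : Hil) : inner ℂ (e n) ψ = ψ n := by
  simp [e, lp.inner_single_left]

theorem norm_e (n : ℤ) : ‖e n‖ = 1 := by
  simp [e, lp.norm_single]

theorem norm_inner_e_right (n : ℤ) (ψ : Hil) : ‖inner ℂ ψ (e n)‖ = ‖ψ n‖ := by
  rw [norm_inner_symm, inner_e_left]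

theorem norm_apply_e_le (A : Hil →L[ℂ] Hil) (n : ℤ) : ‖A (e n)‖ ≤ ‖A‖ := by
  simpa [norm_e] using A.le_opNorm (e n)

theorem norm_inner_e_apply_e_le (A : Hil →L[ℂ] Hil) (n : ℤ) :
    ‖inner ℂ (e n) (A (e n))‖ ≤ ‖A‖ := by
  simpa [norm_e] using (norm_inner_le_norm (𝕜 := ℂ) _ _).trans
    (mul_le_mul_of_nonneg_left (norm_apply_e_le A n) (norm_nonneg (e n)))

theorem hasSum_inner_e_mul_apply (φ ψ : Hil) :
    HasSum (fun n => inner ℂ φ (e n) * ψ n) (inner ℂ φ ψ) := by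
  have coe_default (n : ℤ) : (default : HilbertBasis ℤ ℂ Hil) n = e n := by
    rw [← HilbertBasis.repr_symm_single]; rfl
  simpa only [coe_default, inner_e_left] using
    (default : HilbertBasis ℤ ℂ Hil).hasSum_inner_mul_inner φ ψ

theorem hasSum_norm_apply_sq (ψ : Hil) : HasSum (fun n => ‖ψ n‖ ^ 2) (‖ψ‖ ^ 2) := by
  simpa using lp.hasSum_norm (p := 2) (by norm_num) ψ

theorem summable_and_tsum_mul_le_of_tsum_sq_le {ι : Type*} {f g : ι → ℝ} {a b : ℝ}
    (hf : ∀ i, 0 ≤ f i) (hg : ∀ i, 0 ≤ g i) (ha : 0 ≤ a) (hb : 0 ≤ b)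
    (hfs : Summable fun i => f i ^ 2) (hgs : Summable fun i => g i ^ 2)
    (hfa : ∑' i, f i ^ 2 ≤ a ^ 2) (hgb : ∑' i, g i ^ 2 ≤ b ^ 2) :
    (Summable fun i => f i * g i) ∧ ∑' i, f i * g i ≤ a * b := by
  have holder := Real.summable_and_inner_le_Lp_mul_Lq_tsum_of_nonneg (p := 2) (q := 2)
    Real.HolderConjugate.two_two hf hg (by simpa using hfs) (by simpa using hgs)
  simp only [Real.rpow_two, ← Real.sqrt_eq_rpow] at holder
  exact ⟨holder.1, holder.2.trans <| mul_le_mul (Real.sqrt_le_iff.2 ⟨ha, hfa⟩)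
    (Real.sqrt_le_iff.2 ⟨hb, hgb⟩) (Real.sqrt_nonneg _) ha⟩

theorem summable_and_tsum_norm_mul_norm_le (φ ψ : Hil) :
    (Summable fun n => ‖φ n‖ * ‖ψ n‖) ∧ ∑' n, ‖φ n‖ * ‖ψ n‖ ≤ ‖φ‖ * ‖ψ‖ :=
  summable_and_tsum_mul_le_of_tsum_sq_le (fun _ => norm_nonneg _) (fun _ => norm_nonneg _)
    (norm_nonneg _) (norm_nonneg _) (hasSum_norm_apply_sq φ).summable
    (hasSum_norm_apply_sq ψ).summable (hasSum_norm_apply_sq φ).tsum_eq.le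
    (hasSum_norm_apply_sq ψ).tsum_eq.le

/-! ### Trace class operators -/

section InvAdd

variable {𝔸 : Type*} [CStarAlgebra 𝔸] [PartialOrder 𝔸] [StarOrderedRing 𝔸] {p : 𝔸} {ε : ℝ}

theorem continuousOn_inv_add_spectrum (hp : 0 ≤ p) (hε : 0 < ε) :
    ContinuousOn (fun x : ℝ => (x + ε)⁻¹) (spectrum ℝ p) :=
  ContinuousOn.inv₀ (by fun_prop) fun _ hx =>
    (add_pos_of_nonneg_of_pos (spectrum_nonneg_of_nonneg hp hx) hε).ne'

theorem cfc_inv_add_mul_self_add (hp : 0 ≤ p) (hε : 0 < ε) :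
    cfc (fun x : ℝ => (x + ε)⁻¹) p * p + ε • cfc (fun x : ℝ => (x + ε)⁻¹) p = 1 := by
  have hc := continuousOn_inv_add_spectrum hp hε
  have h_sa : IsSelfAdjoint p := hp.isSelfAdjoint
  nth_rw 2 [← cfc_id' ℝ p]
  rw [← cfc_mul _ (fun x => x) p hc, ← cfc_smul ε _ p hc,
    ← cfc_add p (fun x => (x + ε)⁻¹ * x) (fun x => ε • (x + ε)⁻¹) (hc.mul continuousOn_id)
      (hc.const_smul ε), ← cfc_one ℝ p]
  refine cfc_congr fun x hx => ?_
  have := (add_pos_of_nonneg_of_pos (spectrum_nonneg_of_nonneg hp hx) hε).ne'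
  simp only [smul_eq_mul, Pi.one_apply]
  field_simp

theorem norm_cfc_inv_add_mul_self_le (hp : 0 ≤ p) (hε : 0 < ε) :
    ‖cfc (fun x : ℝ => (x + ε)⁻¹) p * p‖ ≤ 1 := by
  have hc := continuousOn_inv_add_spectrum hp hε
  have h_sa : IsSelfAdjoint p := hp.isSelfAdjoint
  nth_rw 2 [← cfc_id' ℝ p]
  rw [← cfc_mul _ (fun x => x) p hc]
  refine norm_cfc_le zero_le_one fun x hx => ?_
  have hx0 := spectrum_nonneg_of_nonneg hp hx
  rw [inv_mul_eq_div, Real.norm_of_nonneg (by positivity)]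
  exact (div_le_one (by positivity)).2 (by linarith)

/-- The witness is `(|A| + ε)⁻¹ A*`, an approximation of the adjoint of the partial isometry in the
polar decomposition of `A`. -/
theorem exists_norm_abs_sub_mul_le (a : 𝔸) (hε : 0 < ε) :
    ∃ b : 𝔸, ‖b‖ ≤ 1 ∧ ‖CFC.abs a - b * a‖ ≤ ε := by
  have hp := CFC.abs_nonneg a
  have h_sq : CFC.abs a * CFC.abs a = star a * a := CFC.abs_mul_abs a
  set p := CFC.abs a
  set c := cfc (fun x : ℝ => (x + ε)⁻¹) p
  have h_norm : ‖c * p‖ ≤ 1 := norm_cfc_inv_add_mul_self_le hp hε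
  have h_star : star c = c := (cfc_predicate _ p : IsSelfAdjoint c)
  have h_star_p : star p = p := hp.isSelfAdjoint
  refine ⟨c * star a, ?_, ?_⟩
  · have h_norm_eq : ‖c * star a‖ * ‖c * star a‖ = ‖c * p‖ * ‖c * p‖ := by
      rw [← CStarRing.norm_self_mul_star, ← CStarRing.norm_self_mul_star, star_mul, star_mul,
        star_star, h_star, h_star_p, mul_assoc, ← mul_assoc (star a), ← h_sq]
      simp only [mul_assoc]
    rwa [(mul_self_inj (norm_nonneg _) (norm_nonneg _)).1 h_norm_eq]
  · have h_sub : p - c * star a * a = ε • (c * p) := by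
      have h_mul := congrArg (· * p) (cfc_inv_add_mul_self_add hp hε)
      simp only [add_mul, one_mul, smul_mul_assoc] at h_mul
      rw [mul_assoc, ← h_sq, ← mul_assoc]
      exact sub_eq_of_eq_add' h_mul.symm
    rw [h_sub, norm_smul, Real.norm_of_nonneg hε.le]
    exact mul_le_of_le_one_right hε.le h_norm

end InvAdd

theorem absOp_nonneg {E : Type*} [NormedAddCommGroup E] [InnerProductSpace ℂ E] [CompleteSpace E]
    (A : E →L[ℂ] E) : 0 ≤ absOp A :=
  CFC.abs_nonneg A

theorem exists_re_inner_absOp_le (A : Hil →L[ℂ] Hil) {ε : ℝ} (hε : 0 < ε) :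
    ∃ B : Hil →L[ℂ] Hil, ‖B‖ ≤ 1 ∧ ∀ m,
      (inner ℂ (e m) (absOp A (e m))).re ≤ ‖inner ℂ (e m) ((B * A) (e m))‖ + ε := by
  obtain ⟨B, hB, hBA⟩ := exists_norm_abs_sub_mul_le A hε
  refine ⟨B, hB, fun m => ?_⟩
  have h_split : inner ℂ (e m) (absOp A (e m)) = inner ℂ (e m) ((B * A) (e m))
      + inner ℂ (e m) ((absOp A - B * A) (e m)) := by
    rw [← inner_add_right, sub_apply, add_sub_cancel]
  rw [h_split]
  refine (Complex.re_le_norm _).trans ((norm_add_le _ _).trans ?_)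
  gcongr
  exact (norm_inner_e_apply_e_le _ m).trans hBA

theorem isTraceClass_of_sum_norm_inner_le {A : Hil →L[ℂ] Hil} {K : ℝ}
    (hK : ∀ B : Hil →L[ℂ] Hil, ‖B‖ ≤ 1 → ∀ s : Finset ℤ,
      ∑ m ∈ s, ‖inner ℂ (e m) ((B * A) (e m))‖ ≤ K) : IsTraceClass A := by
  have h_nonneg (m : ℤ) : 0 ≤ (inner ℂ (e m) (absOp A (e m))).re :=
    ((ContinuousLinearMap.nonneg_iff_isPositive _).1 (absOp_nonneg A)).re_inner_nonneg_right (e m)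
  refine summable_of_sum_le h_nonneg (c := K) fun s => le_of_forall_pos_le_add fun ε hε => ?_
  obtain ⟨B, hB, hBA⟩ := exists_re_inner_absOp_le A (ε := ε / (s.card + 1)) (by positivity)
  calc ∑ m ∈ s, (inner ℂ (e m) (absOp A (e m))).re
      ≤ ∑ m ∈ s, (‖inner ℂ (e m) ((B * A) (e m))‖ + ε / (s.card + 1)) :=
        Finset.sum_le_sum fun m _ => hBA m
    _ = ∑ m ∈ s, ‖inner ℂ (e m) ((B * A) (e m))‖ + s.card * (ε / (s.card + 1)) := by
        rw [Finset.sum_add_distrib, Finset.sum_const, nsmul_eq_mul]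
    _ ≤ K + ε := by
        refine add_le_add (hK B hB s) ?_
        rw [mul_div_assoc', div_le_iff₀ (by positivity)]
        nlinarith

theorem IsTraceClass.neg {A : Hil →L[ℂ] Hil} (hA : IsTraceClass A) : IsTraceClass (-A) := by
  have h_abs : absOp (-A) = absOp A := by simp [absOp, CFC.abs_neg]
  rwa [IsTraceClass, h_abs]

theorem trace_im_eq_zero {A : Hil →L[ℂ] Hil} (hA : IsSelfAdjoint A) : (trace A).im = 0 := by
  rw [← Complex.conj_eq_iff_im, trace, Complex.conj_tsum]
  refine tsum_congr fun m => ?_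
  rw [inner_conj_symm]
  exact (ContinuousLinearMap.isSelfAdjoint_iff_isSymmetric.1 hA) (e m) (e m)

/-! ### Nuclear expansions -/

theorem norm_apply_mul_norm_adjoint_apply_le (A C : Hil →L[ℂ] Hil) (φ ψ : Hil) :
    ‖A φ‖ * ‖C.adjoint ψ‖ ≤ ‖A‖ * ‖C‖ * (‖φ‖ * ‖ψ‖) :=
  calc ‖A φ‖ * ‖C.adjoint ψ‖
      ≤ (‖A‖ * ‖φ‖) * (‖C.adjoint‖ * ‖ψ‖) := by
        gcongr <;> exact ContinuousLinearMap.le_opNorm _ _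
    _ = ‖A‖ * ‖C‖ * (‖φ‖ * ‖ψ‖) := by rw [LinearIsometryEquiv.norm_map]; ring

/-- The weak expansion `A = ∑ i, |x i⟩⟨y i|` of an operator into operators of rank one with
`∑ i, ‖x i‖ * ‖y i‖ < ∞`. An operator with such an expansion is trace class, and its trace is
`∑ i, ⟪y i, x i⟫`. -/
structure HasNuclearExpansion {ι : Type*} (A : Hil →L[ℂ] Hil) (x y : ι → Hil) : Prop where
  summable_norm : Summable fun i => ‖x i‖ * ‖y i‖
  hasSum_inner : ∀ φ ψ, HasSum (fun i => inner ℂ φ (x i) * inner ℂ (y i) ψ) (inner ℂ φ (A ψ))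

namespace HasNuclearExpansion

variable {ι κ : Type*} {N N' : Hil →L[ℂ] Hil} {x y : ι → Hil} {x' y' : κ → Hil}

theorem hasSum_norm_sumElim (hN : HasNuclearExpansion N x y)
    (hN' : HasNuclearExpansion N' x' y') :
    HasSum (fun i => ‖Sum.elim x x' i‖ * ‖Sum.elim y y' i‖)
      (∑' i, ‖x i‖ * ‖y i‖ + ∑' i, ‖x' i‖ * ‖y' i‖) :=
  HasSum.sum (f := fun i => ‖Sum.elim x x' i‖ * ‖Sum.elim y y' i‖)
    hN.summable_norm.hasSum hN'.summable_norm.hasSum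

theorem add (hN : HasNuclearExpansion N x y) (hN' : HasNuclearExpansion N' x' y') :
    HasNuclearExpansion (N + N') (Sum.elim x x') (Sum.elim y y') where
  summable_norm := (hN.hasSum_norm_sumElim hN').summable
  hasSum_inner φ ψ := by
    rw [add_apply, inner_add_right]
    exact HasSum.sum (f := fun i => inner ℂ φ (Sum.elim x x' i) * inner ℂ (Sum.elim y y' i) ψ)
      (hN.hasSum_inner φ ψ) (hN'.hasSum_inner φ ψ)

theorem mul_mul (hN : HasNuclearExpansion N x y) (A C : Hil →L[ℂ] Hil) :
    HasNuclearExpansion (A * N * C) (fun i => A (x i)) (fun i => C.adjoint (y i)) where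
  summable_norm := Summable.of_nonneg_of_le (fun i => by positivity)
    (fun i => norm_apply_mul_norm_adjoint_apply_le A C (x i) (y i))
    (hN.summable_norm.mul_left (‖A‖ * ‖C‖))
  hasSum_inner φ ψ := by
    have h_sum := hN.hasSum_inner (A.adjoint φ) (C ψ)
    simp only [ContinuousLinearMap.adjoint_inner_left] at h_sum ⊢
    exact h_sum

theorem tsum_norm_mul_mul_le (hN : HasNuclearExpansion N x y) (A C : Hil →L[ℂ] Hil) :
    ∑' i, ‖A (x i)‖ * ‖C.adjoint (y i)‖ ≤ ‖A‖ * ‖C‖ * ∑' i, ‖x i‖ * ‖y i‖ := by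
  rw [← tsum_mul_left]
  exact (hN.mul_mul A C).summable_norm.tsum_le_tsum
    (fun i => norm_apply_mul_norm_adjoint_apply_le A C (x i) (y i)) (hN.summable_norm.mul_left _)

theorem summable_norm_diag (hN : HasNuclearExpansion N x y) :
    Summable fun p : ι × ℤ => ‖inner ℂ (e p.2) (x p.1) * inner ℂ (y p.1) (e p.2)‖ := by
  rw [summable_prod_of_nonneg fun _ => norm_nonneg _]
  simp only [norm_mul, inner_e_left, norm_inner_e_right]
  exact ⟨fun i => (summable_and_tsum_norm_mul_norm_le (x i) (y i)).1,
    Summable.of_nonneg_of_le (fun i => tsum_nonneg fun _ => by positivity)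
      (fun i => (summable_and_tsum_norm_mul_norm_le (x i) (y i)).2) hN.summable_norm⟩

theorem hasSum_trace (hN : HasNuclearExpansion N x y) :
    HasSum (fun m => inner ℂ (e m) (N (e m))) (∑' i, inner ℂ (y i) (x i)) := by
  have h_sum := hN.summable_norm_diag.of_norm.hasSum
  have h_rows := h_sum.prod_fiberwise fun i => by
    simpa only [inner_e_left, mul_comm] using hasSum_inner_e_mul_apply (y i) (x i)
  rw [h_rows.tsum_eq]
  exact ((Equiv.prodComm ℤ ι).hasSum_iff.2 h_sum).prod_fiberwise fun m =>
    hN.hasSum_inner (e m) (e m)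

theorem trace_eq (hN : HasNuclearExpansion N x y) : trace N = ∑' i, inner ℂ (y i) (x i) :=
  hN.hasSum_trace.tsum_eq

theorem hasSum_inner_apply (hN : HasNuclearExpansion N x y) :
    HasSum (fun m => inner ℂ (e m) (N (e m))) (trace N) :=
  hN.hasSum_trace.summable.hasSum

theorem norm_trace_le (hN : HasNuclearExpansion N x y) : ‖trace N‖ ≤ ∑' i, ‖x i‖ * ‖y i‖ := by
  rw [hN.trace_eq]
  refine tsum_of_norm_bounded hN.summable_norm.hasSum fun i => ?_
  rw [mul_comm]
  exact norm_inner_le_norm _ _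

theorem sum_norm_inner_le (hN : HasNuclearExpansion N x y) (s : Finset ℤ) :
    ∑ m ∈ s, ‖inner ℂ (e m) (N (e m))‖ ≤ ∑' i, ‖x i‖ * ‖y i‖ := by
  let f (i : ι) (m : ℤ) : ℝ := ‖inner ℂ (e m) (x i) * inner ℂ (y i) (e m)‖
  have hf : Summable fun p : ι × ℤ => f p.1 p.2 := hN.summable_norm_diag
  have h_diag (m : ℤ) : ‖inner ℂ (e m) (N (e m))‖ ≤ ∑' i, f i m := by
    rw [← (hN.hasSum_inner (e m) (e m)).tsum_eq]
    exact norm_tsum_le_tsum_norm (hf.prod_symm.prod_factor m)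
  calc ∑ m ∈ s, ‖inner ℂ (e m) (N (e m))‖
      ≤ ∑ m ∈ s, ∑' i, f i m := Finset.sum_le_sum fun m _ => h_diag m
    _ ≤ ∑' m, ∑' i, f i m :=
        hf.prod_symm.prod.sum_le_tsum s fun m _ => tsum_nonneg fun _ => norm_nonneg _
    _ = ∑' i, ∑' m, f i m := hf.tsum_comm
    _ ≤ ∑' i, ‖x i‖ * ‖y i‖ := by
        refine hf.prod.tsum_le_tsum (fun i => ?_) hN.summable_norm
        simp only [f, norm_mul, inner_e_left, norm_inner_e_right]
        exact (summable_and_tsum_norm_mul_norm_le (x i) (y i)).2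

theorem sum_norm_inner_mul_mul_le (hN : HasNuclearExpansion N x y) (A C : Hil →L[ℂ] Hil)
    (s : Finset ℤ) :
    ∑ m ∈ s, ‖inner ℂ (e m) ((A * N * C) (e m))‖ ≤ ‖A‖ * ‖C‖ * ∑' i, ‖x i‖ * ‖y i‖ :=
  ((hN.mul_mul A C).sum_norm_inner_le s).trans (hN.tsum_norm_mul_mul_le A C)

theorem isTraceClass_mul_mul (hN : HasNuclearExpansion N x y) (A C : Hil →L[ℂ] Hil) :
    IsTraceClass (A * N * C) := by
  refine isTraceClass_of_sum_norm_inner_le (K := ‖A‖ * ‖C‖ * ∑' i, ‖x i‖ * ‖y i‖)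
    fun B hB s => ?_
  have h_tsum : 0 ≤ ∑' i, ‖x i‖ * ‖y i‖ := tsum_nonneg fun i => by positivity
  have h_norm : ‖B * A‖ ≤ ‖A‖ :=
    (norm_mul_le _ _).trans (mul_le_of_le_one_left (norm_nonneg _) hB)
  rw [← mul_assoc, ← mul_assoc]
  exact (hN.sum_norm_inner_mul_mul_le (B * A) C s).trans
    (mul_le_mul_of_nonneg_right (mul_le_mul_of_nonneg_right h_norm (norm_nonneg C)) h_tsum)

theorem trace_mul_mul (hN : HasNuclearExpansion N x y) (A C : Hil →L[ℂ] Hil) :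
    trace (A * N * C) = trace (N * (C * A)) := by
  have h_right := hN.mul_mul 1 (C * A)
  rw [one_mul] at h_right
  rw [(hN.mul_mul A C).trace_eq, h_right.trace_eq]
  simp only [ContinuousLinearMap.adjoint_inner_left, one_apply_eq_self,
    mul_apply_eq_comp]

end HasNuclearExpansion

/-! ### Summable sequences -/

namespace L1

variable (h : L1)

theorem abs_apply_le (n : ℤ) : |h n| ≤ ‖h‖ := by
  simpa using lp.norm_apply_le_norm (by norm_num) h n

theorem exists_abs_apply_le : ∃ M : ℝ, ∀ n, |h n| ≤ M := ⟨‖h‖, h.abs_apply_le⟩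

theorem hasSum_abs : HasSum (fun n => |h n|) ‖h‖ := by
  simpa using lp.hasSum_norm (p := 1) (by norm_num) h

theorem summable_smul_and_norm_tsum_le {E : Type*} [NormedAddCommGroup E] [NormedSpace ℝ E]
    [CompleteSpace E] {b : ℤ → E} {M : ℝ} (hb : ∀ n, ‖b n‖ ≤ M) :
    Summable (fun n => h n • b n) ∧ ‖∑' n, h n • b n‖ ≤ M * ‖h‖ := by
  have h_le (n : ℤ) : ‖h n • b n‖ ≤ M * |h n| := by
    rw [norm_smul, Real.norm_eq_abs, mul_comm]
    exact mul_le_mul_of_nonneg_right (hb n) (abs_nonneg _)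
  have h_sum := h.hasSum_abs.mul_left M
  exact ⟨Summable.of_norm_bounded h_sum.summable h_le, tsum_of_norm_bounded h_sum h_le⟩

end L1

theorem toL2_apply (h : L1) (n : ℤ) : toL2 h n = h n := rfl

theorem L2.hasSum_sq (h : L2) : HasSum (fun n => h n ^ 2) (‖h‖ ^ 2) := by
  simpa using lp.hasSum_norm (p := 2) (by norm_num) h

theorem norm_toL2_le (h : L1) : ‖toL2 h‖ ≤ ‖h‖ := by
  refine le_of_sq_le_sq ?_ (norm_nonneg h)
  rw [sq ‖h‖]
  refine hasSum_le (fun n => ?_) (L2.hasSum_sq (toL2 h)) (h.hasSum_abs.mul_left ‖h‖)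
  rw [toL2_apply, ← sq_abs, sq]
  exact mul_le_mul_of_nonneg_right (h.abs_apply_le n) (abs_nonneg _)

/-- The inclusion `ℓ¹ ⊆ ℓ²` as a continuous linear map. -/
def toL2L : L1 →L[ℝ] L2 :=
  LinearMap.mkContinuous
    { toFun := toL2
      map_add' := fun _ _ => rfl
      map_smul' := fun _ _ => rfl } 1 fun h => by
      rw [one_mul]; exact norm_toL2_le h

theorem denseRange_toL2L : DenseRange toL2L := by
  intro f
  refine mem_closure_of_tendsto (lp.hasSum_single (p := 2) (by norm_num) f)
    (Filter.Eventually.of_forall fun s => ?_)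
  exact Submodule.sum_mem (LinearMap.range toL2L.toLinearMap) fun n _ =>
    ⟨lp.single 1 n (f n), by ext m; rfl⟩

/-! ### Hopping operators -/

instance instNormedSpaceRealOperators : NormedSpace ℝ (Hil →L[ℂ] Hil) :=
  NormedSpace.complexToReal

instance instModuleRealOperators : Module ℝ (Hil →L[ℂ] Hil) :=
  instNormedSpaceRealOperators.toModule

section Hop

variable {a b : ℤ → ℝ}

theorem mulShift_apply {M : ℝ} (hM : ∀ n, |a n| ≤ M) (k : ℤ) (ψ : Hil) (n : ℤ) :
    mulShift a M hM k ψ n = (a n : ℂ) * ψ (n + k) := rfl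

theorem mulShift_adjoint {M : ℝ} (hM : ∀ n, |a n| ≤ M) (k : ℤ) :
    (mulShift a M hM k).adjoint =
      mulShift (fun n => a (n - k)) M (fun n => hM (n - k)) (-k) := by
  refine ((ContinuousLinearMap.eq_adjoint_iff _ _).2 fun φ ψ => ?_).symm
  have h_left := lp.hasSum_inner (𝕜 := ℂ)
    (mulShift (fun n => a (n - k)) M (fun n => hM (n - k)) (-k) φ) ψ
  have h_right := lp.hasSum_inner (𝕜 := ℂ) φ (mulShift a M hM k ψ)
  refine ((Equiv.addRight k).hasSum_iff.2 h_left).unique ?_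
  convert h_right using 2 with n
  simp only [Function.comp_apply, Equiv.coe_addRight, mulShift_apply, RCLike.inner_apply', map_mul,
    Complex.conj_ofReal, add_sub_cancel_right, add_neg_cancel_right]
  ring

theorem hop_eq_mulShift_add {M : ℝ} (hM : ∀ n, |a n| ≤ M) :
    hop a = mulShift a M hM 1 +
      mulShift (fun n => a (n - 1)) M (fun n => hM (n - 1)) (-1) := by
  rw [hop, dif_pos ⟨M, hM⟩]
  rfl

theorem norm_hop_le {M : ℝ} (hM : ∀ n, |a n| ≤ M) : ‖hop a‖ ≤ 2 * M := by
  have hM0 : 0 ≤ M := (abs_nonneg _).trans (hM 0)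
  rw [hop_eq_mulShift_add hM, two_mul]
  exact (norm_add_le _ _).trans (add_le_add (LinearMap.mkContinuous_norm_le _ hM0 _)
    (LinearMap.mkContinuous_norm_le _ hM0 _))

theorem hop_add (ha : ∃ M : ℝ, ∀ n, |a n| ≤ M) (hb : ∃ M : ℝ, ∀ n, |b n| ≤ M) :
    hop (a + b) = hop a + hop b := by
  have hab : ∃ M : ℝ, ∀ n, |(a + b) n| ≤ M := by
    obtain ⟨M, hM⟩ := ha
    obtain ⟨N, hN⟩ := hb
    exact ⟨M + N, fun n => (abs_add_le _ _).trans (add_le_add (hM n) (hN n))⟩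
  ext ψ n
  change hop (a + b) ψ n = hop a ψ n + hop b ψ n
  rw [hop_apply hab, hop_apply ha, hop_apply hb]
  simp only [Pi.add_apply, Complex.ofReal_add]
  ring

theorem hop_smul (c : ℝ) (ha : ∃ M : ℝ, ∀ n, |a n| ≤ M) : hop (c • a) = c • hop a := by
  have hca : ∃ M : ℝ, ∀ n, |(c • a) n| ≤ M := by
    obtain ⟨M, hM⟩ := ha
    refine ⟨|c| * M, fun n => ?_⟩
    rw [Pi.smul_apply, smul_eq_mul, abs_mul]
    exact mul_le_mul_of_nonneg_left (hM n) (abs_nonneg c)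
  ext ψ n
  change hop (c • a) ψ n = (c : ℂ) * hop a ψ n
  rw [hop_apply hca, hop_apply ha]
  simp only [Pi.smul_apply, smul_eq_mul, Complex.ofReal_mul]
  ring

theorem e_apply (n m : ℤ) : e n m = if m = n then 1 else 0 := by
  rw [e, lp.single_apply, Pi.single_apply]

theorem hop_e (ha : ∃ M : ℝ, ∀ n, |a n| ≤ M) (m : ℤ) :
    hop a (e m) = (a (m - 1) : ℂ) • e (m - 1) + (a m : ℂ) • e (m + 1) := by
  ext n
  change hop a (e m) n = (a (m - 1) : ℂ) * e (m - 1) n + (a m : ℂ) * e (m + 1) n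
  simp only [hop_apply ha, e_apply, mul_ite, mul_one, mul_zero]
  grind

theorem isSelfAdjoint_hop (ha : ∃ M : ℝ, ∀ n, |a n| ≤ M) : IsSelfAdjoint (hop a) := by
  obtain ⟨M, hM⟩ := ha
  rw [hop_eq_mulShift_add hM, ← mulShift_adjoint hM 1]
  exact IsSelfAdjoint.add_star_self _

theorem hasNuclearExpansion_mulShift {M : ℝ} (hM : ∀ n, |a n| ≤ M) (k : ℤ)
    (ha : Summable fun n => |a n|) :
    HasNuclearExpansion (mulShift a M hM k) (fun n => (a n : ℂ) • e n) (fun n => e (n + k)) where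
  summable_norm := by
    simpa only [norm_smul, norm_e, mul_one, Complex.norm_real, Real.norm_eq_abs] using ha
  hasSum_inner φ ψ := by
    convert hasSum_inner_e_mul_apply φ (mulShift a M hM k ψ) using 2 with n
    rw [inner_smul_right, inner_e_left, mulShift_apply]
    ring

end Hop

theorem exists_hasNuclearExpansion_hop (h : L1) : ∃ x y : ℤ ⊕ ℤ → Hil,
    HasNuclearExpansion (hop h) x y ∧ ∑' i, ‖x i‖ * ‖y i‖ ≤ 2 * ‖h‖ := by
  have h_abs := h.hasSum_abs
  have h_abs_shift : HasSum (fun n => |h (n - 1)|) ‖h‖ :=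
    (Equiv.subRight (1 : ℤ)).hasSum_iff.2 h_abs
  have h_right := hasNuclearExpansion_mulShift h.abs_apply_le 1 h_abs.summable
  have h_left := hasNuclearExpansion_mulShift (fun n => h.abs_apply_le (n - 1)) (-1)
    h_abs_shift.summable
  rw [hop_eq_mulShift_add h.abs_apply_le]
  refine ⟨_, _, h_right.add h_left, le_of_eq ?_⟩
  rw [(h_right.hasSum_norm_sumElim h_left).tsum_eq]
  simp only [norm_smul, norm_e, mul_one, Complex.norm_real, Real.norm_eq_abs]
  rw [h_abs.tsum_eq, h_abs_shift.tsum_eq, two_mul]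

/-- The map `h ↦ H` on `ℓ¹`. -/
def hopL : L1 →L[ℝ] (Hil →L[ℂ] Hil) :=
  LinearMap.mkContinuous
    { toFun := fun h => hop h
      map_add' := fun h k => hop_add h.exists_abs_apply_le k.exists_abs_apply_le
      map_smul' := fun c h => hop_smul c h.exists_abs_apply_le } 2
    fun h => norm_hop_le h.abs_apply_le

@[simp] theorem hopL_apply (h : L1) : hopL h = hop h := rfl

/-! ### The pairing `(h, X) ↦ Tr (H X)` -/

section HopTrace

variable (h k : L1) (A C X Y : Hil →L[ℂ] Hil)

theorem hasSum_inner_hop_mul :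
    HasSum (fun m => inner ℂ (e m) ((hop h * X) (e m))) (trace (hop h * X)) := by
  obtain ⟨x, y, hN, -⟩ := exists_hasNuclearExpansion_hop h
  simpa only [one_mul] using (hN.mul_mul 1 X).hasSum_inner_apply

theorem norm_trace_hop_mul_le : ‖trace (hop h * X)‖ ≤ 2 * ‖h‖ * ‖X‖ := by
  obtain ⟨x, y, hN, hle⟩ := exists_hasNuclearExpansion_hop h
  rw [← one_mul (hop h)]
  calc ‖trace (1 * hop h * X)‖ ≤ ‖(1 : Hil →L[ℂ] Hil)‖ * ‖X‖ * ∑' i, ‖x i‖ * ‖y i‖ :=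
        (hN.mul_mul 1 X).norm_trace_le.trans (hN.tsum_norm_mul_mul_le 1 X)
    _ ≤ 1 * ‖X‖ * (2 * ‖h‖) := by
        gcongr
        exact ContinuousLinearMap.norm_id_le
    _ = 2 * ‖h‖ * ‖X‖ := by ring

theorem isTraceClass_mul_hop_mul : IsTraceClass (A * hop h * C) := by
  obtain ⟨x, y, hN, -⟩ := exists_hasNuclearExpansion_hop h
  exact hN.isTraceClass_mul_mul A C

/-- The complex linear form `X ↦ Tr (H X)` on bounded operators. -/
def hopTraceC : (Hil →L[ℂ] Hil) →L[ℂ] ℂ :=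
  LinearMap.mkContinuous
    { toFun := fun X => trace (hop h * X)
      map_add' := fun X Y => by
        refine (((hasSum_inner_hop_mul h X).add (hasSum_inner_hop_mul h Y)).congr_fun
          fun m => ?_).tsum_eq
        rw [← inner_add_right, mul_add, add_apply]
      map_smul' := fun c X => by
        refine (((hasSum_inner_hop_mul h X).mul_left c).congr_fun fun m => ?_).tsum_eq
        rw [← inner_smul_right, mul_smul_comm, smul_apply] }
    (2 * ‖h‖) (norm_trace_hop_mul_le h)

/-- The real bilinear form `(h, X) ↦ Tr (H X)`. -/
def hopTrace : L1 →L[ℝ] (Hil →L[ℂ] Hil) →L[ℝ] ℂ :=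
  LinearMap.mkContinuous
    { toFun := fun h => (hopTraceC h).restrictScalars ℝ
      map_add' := fun h k => by
        ext X
        refine (((hasSum_inner_hop_mul h X).add (hasSum_inner_hop_mul k X)).congr_fun
          fun m => ?_).tsum_eq
        rw [← inner_add_right, ← hopL_apply, map_add]
        rfl
      map_smul' := fun c h => by
        ext X
        refine (((hasSum_inner_hop_mul h X).mul_left (c : ℂ)).congr_fun fun m => ?_).tsum_eq
        rw [← inner_smul_right, ← hopL_apply, map_smul]
        rfl }
    2 fun h => (hopTraceC h).opNorm_le_bound (by positivity) (norm_trace_hop_mul_le h)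

theorem hopTrace_apply : hopTrace h X = trace (hop h * X) := rfl

theorem trace_mul_hop_mul : trace (A * hop h * C) = hopTrace h (C * A) := by
  obtain ⟨x, y, hN, -⟩ := exists_hasNuclearExpansion_hop h
  exact hN.trace_mul_mul A C

end HopTrace

/-! ### Hilbert–Schmidt bounds -/

/-- The Hilbert–Schmidt norm of `X` is finite and at most `K`. -/
structure HasHilbertSchmidtBound (X : Hil →L[ℂ] Hil) (K : ℝ) : Prop where
  nonneg : 0 ≤ K
  summable_sq : Summable fun n => ‖X (e n)‖ ^ 2
  tsum_sq_le : ∑' n, ‖X (e n)‖ ^ 2 ≤ K ^ 2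

namespace HasHilbertSchmidtBound

variable {X Y : Hil →L[ℂ] Hil} {K L : ℝ}

theorem adjoint (hX : HasHilbertSchmidtBound X K) : HasHilbertSchmidtBound X.adjoint K := by
  have h_prod : Summable fun p : ℤ × ℤ => ‖X (e p.1) p.2‖ ^ 2 := by
    rw [summable_prod_of_nonneg fun _ => sq_nonneg _]
    refine ⟨fun n => (hasSum_norm_apply_sq (X (e n))).summable, ?_⟩
    simpa only [(hasSum_norm_apply_sq _).tsum_eq] using hX.summable_sq
  have h_rows : HasSum (fun n => ‖X (e n)‖ ^ 2) (∑' p : ℤ × ℤ, ‖X (e p.1) p.2‖ ^ 2) :=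
    h_prod.hasSum.prod_fiberwise fun n => hasSum_norm_apply_sq (X (e n))
  have h_columns : HasSum (fun m => ‖X.adjoint (e m)‖ ^ 2)
      (∑' p : ℤ × ℤ, ‖X (e p.1) p.2‖ ^ 2) := by
    refine ((Equiv.prodComm ℤ ℤ).hasSum_iff.2 h_prod.hasSum).prod_fiberwise fun m => ?_
    refine (hasSum_norm_apply_sq (X.adjoint (e m))).congr_fun fun n => ?_
    change ‖X (e n) m‖ ^ 2 = ‖X.adjoint (e m) n‖ ^ 2
    rw [← norm_inner_e_right n, ContinuousLinearMap.adjoint_inner_left, inner_e_left]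
  exact ⟨hX.nonneg, h_columns.summable,
    h_columns.tsum_eq.trans h_rows.tsum_eq.symm |>.trans_le hX.tsum_sq_le⟩

theorem mul_left (hX : HasHilbertSchmidtBound X K) (A : Hil →L[ℂ] Hil) :
    HasHilbertSchmidtBound (A * X) (‖A‖ * K) := by
  have h_le (n : ℤ) : ‖(A * X) (e n)‖ ^ 2 ≤ ‖A‖ ^ 2 * ‖X (e n)‖ ^ 2 := by
    rw [← mul_pow]
    gcongr
    exact A.le_opNorm _
  have h_summable := hX.summable_sq.mul_left (‖A‖ ^ 2)
  have h_summable' := Summable.of_nonneg_of_le (fun _ => sq_nonneg _) h_le h_summable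
  refine ⟨mul_nonneg (norm_nonneg A) hX.nonneg, h_summable',
    (h_summable'.tsum_le_tsum h_le h_summable).trans ?_⟩
  rw [tsum_mul_left, mul_pow]
  exact mul_le_mul_of_nonneg_left hX.tsum_sq_le (sq_nonneg _)

theorem mul_right (hX : HasHilbertSchmidtBound X K) (A : Hil →L[ℂ] Hil) :
    HasHilbertSchmidtBound (X * A) (‖A‖ * K) := by
  have h_adjoint := (hX.adjoint.mul_left A.adjoint).adjoint
  rwa [LinearIsometryEquiv.norm_map, ← ContinuousLinearMap.star_eq_adjoint,
    ← ContinuousLinearMap.star_eq_adjoint, ← ContinuousLinearMap.star_eq_adjoint, star_mul,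
    star_star, star_star] at h_adjoint

theorem norm_trace_mul_le (hX : HasHilbertSchmidtBound X K) (hY : HasHilbertSchmidtBound Y L) :
    ‖trace (X * Y)‖ ≤ K * L := by
  obtain ⟨h_summable, h_le⟩ := summable_and_tsum_mul_le_of_tsum_sq_le
    (f := fun m => ‖X.adjoint (e m)‖) (g := fun m => ‖Y (e m)‖) (fun _ => norm_nonneg _)
    (fun _ => norm_nonneg _) hX.nonneg hY.nonneg hX.adjoint.summable_sq hY.summable_sq
    hX.adjoint.tsum_sq_le hY.tsum_sq_le
  refine (tsum_of_norm_bounded h_summable.hasSum fun m => ?_).trans h_le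
  rw [mul_apply_eq_comp, ← ContinuousLinearMap.adjoint_inner_left]
  exact norm_inner_le_norm _ _

end HasHilbertSchmidtBound

theorem hasHilbertSchmidtBound_hop (h : L1) : HasHilbertSchmidtBound (hop h) (2 * ‖toL2 h‖) := by
  have h_norm (m : ℤ) : ‖hop h (e m)‖ ≤ |h (m - 1)| + |h m| := by
    rw [hop_e h.exists_abs_apply_le]
    refine (norm_add_le _ _).trans (le_of_eq ?_)
    simp only [norm_smul, norm_e, Complex.norm_real, Real.norm_eq_abs, mul_one]
  have h_le (m : ℤ) : ‖hop h (e m)‖ ^ 2 ≤ 2 * (h (m - 1) ^ 2 + h m ^ 2) := by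
    calc ‖hop h (e m)‖ ^ 2 ≤ (|h (m - 1)| + |h m|) ^ 2 := by gcongr; exact h_norm m
      _ ≤ 2 * (|h (m - 1)| ^ 2 + |h m| ^ 2) := add_sq_le
      _ = 2 * (h (m - 1) ^ 2 + h m ^ 2) := by simp only [sq_abs]
  have h_sq : HasSum (fun m => h m ^ 2) (‖toL2 h‖ ^ 2) := L2.hasSum_sq (toL2 h)
  have h_sq_shift : HasSum (fun m => h (m - 1) ^ 2) (‖toL2 h‖ ^ 2) :=
    (Equiv.subRight (1 : ℤ)).hasSum_iff.2 h_sq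
  have h_sum := (h_sq_shift.add h_sq).mul_left 2
  have h_summable := Summable.of_nonneg_of_le (fun _ => sq_nonneg _) h_le h_sum.summable
  exact ⟨by positivity, h_summable,
    (hasSum_le h_le h_summable.hasSum h_sum).trans (le_of_eq (by ring))⟩

theorem norm_hopTrace_mul_hop_mul_le (k h : L1) (A B : Hil →L[ℂ] Hil) :
    ‖hopTrace k (A * hop h * B)‖ ≤ 4 * ‖A‖ * ‖B‖ * ‖toL2 k‖ * ‖toL2 h‖ := by
  rw [hopTrace_apply]
  refine ((hasHilbertSchmidtBound_hop k).norm_trace_mul_le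
    (((hasHilbertSchmidtBound_hop h).mul_left A).mul_right B)).trans (le_of_eq ?_)
  ring

/-! ### Regularity of contours -/

theorem exists_consecutive {S : Finset ℝ} (zero_mem : (0 : ℝ) ∈ S)
    (one_mem : (1 : ℝ) ∈ S) {s : ℝ} (hs : s ∈ Set.Icc (0 : ℝ) 1) :
    ∃ a ∈ S, ∃ b ∈ S, a < b ∧ Disjoint (Set.Ioo a b) (S : Set ℝ) ∧ s ∈ Set.Icc a b := by
  rcases hs.2.lt_or_eq with hlt | rfl
  · have h_le : (S.filter (· ≤ s)).Nonempty := ⟨0, by simp [zero_mem, hs.1]⟩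
    have h_gt : (S.filter (s < ·)).Nonempty := ⟨1, by simp [one_mem, hlt]⟩
    have ha := Finset.mem_filter.1 (Finset.max'_mem _ h_le)
    have hb := Finset.mem_filter.1 (Finset.min'_mem _ h_gt)
    refine ⟨_, ha.1, _, hb.1, ha.2.trans_lt hb.2, ?_, ha.2, hb.2.le⟩
    rw [Set.disjoint_left]
    intro x hx hxS
    rcases le_or_gt x s with h | h
    · exact absurd (Finset.le_max' _ x (Finset.mem_filter.2 ⟨hxS, h⟩)) (not_le.2 hx.1)
    · exact absurd (Finset.min'_le _ x (Finset.mem_filter.2 ⟨hxS, h⟩)) (not_le.2 hx.2)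
  · have h_le : (S.filter (· < (1 : ℝ))).Nonempty := ⟨0, by simp [zero_mem]⟩
    have ha := Finset.mem_filter.1 (Finset.max'_mem _ h_le)
    refine ⟨_, ha.1, 1, one_mem, ha.2, ?_, ha.2.le, le_rfl⟩
    rw [Set.disjoint_left]
    intro x hx hxS
    exact absurd (Finset.le_max' _ x (Finset.mem_filter.2 ⟨hxS, hx.2⟩)) (not_le.2 hx.1)

theorem Contour.continuousOn (γ : Contour) : ContinuousOn γ.toFun (Set.Icc 0 1) := by
  obtain ⟨S, -, zero_mem, one_mem, hC⟩ := γ.piecewise_C1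
  let Piece := {p : S × S // p.1.1 < p.2.1 ∧ Disjoint (Set.Ioo p.1.1 p.2.1) (S : Set ℝ)}
  have h_union : ContinuousOn γ.toFun (⋃ p : Piece, Set.Icc p.1.1.1 p.1.2.1) :=
    (locallyFinite_of_finite _).continuousOn_iUnion (fun _ => isClosed_Icc) fun p =>
      (hC _ p.1.1.2 _ p.1.2.2 p.2.1 p.2.2).continuousOn
  refine h_union.mono fun s hs => ?_
  obtain ⟨a, ha, b, hb, hab, hd, hsab⟩ := exists_consecutive zero_mem one_mem hs
  exact Set.mem_iUnion.2 ⟨⟨(⟨a, ha⟩, ⟨b, hb⟩), hab, hd⟩, hsab⟩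

theorem Contour.exists_deriv_bound (γ : Contour) : ∃ (S : Finset ℝ) (C : ℝ), 0 ≤ C ∧
    ∀ s ∈ Set.Icc (0 : ℝ) 1, s ∉ S →
      DifferentiableAt ℝ γ.toFun s ∧ ‖deriv γ.toFun s‖ ≤ C := by
  obtain ⟨S, -, zero_mem, one_mem, hC⟩ := γ.piecewise_C1
  let Piece := {p : S × S // p.1.1 < p.2.1 ∧ Disjoint (Set.Ioo p.1.1 p.2.1) (S : Set ℝ)}
  have h_piece : ∀ p : Piece, ∃ K, ∀ s ∈ Set.Ioo p.1.1.1 p.1.2.1,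
      DifferentiableAt ℝ γ.toFun s ∧ ‖deriv γ.toFun s‖ ≤ K := fun p => by
    have h_C1 := hC _ p.1.1.2 _ p.1.2.2 p.2.1 p.2.2
    obtain ⟨K, hK⟩ := isCompact_Icc.exists_bound_of_continuousOn
      (h_C1.continuousOn_derivWithin (uniqueDiffOn_Icc p.2.1) le_rfl)
    refine ⟨K, fun s hs => ?_⟩
    have h_nhds : Set.Icc p.1.1.1 p.1.2.1 ∈ nhds s := Icc_mem_nhds hs.1 hs.2
    refine ⟨(h_C1.differentiableOn one_ne_zero s (Set.Ioo_subset_Icc_self hs)).differentiableAt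
      h_nhds, ?_⟩
    rw [← derivWithin_of_mem_nhds h_nhds]
    exact hK s (Set.Ioo_subset_Icc_self hs)
  choose K hK using h_piece
  obtain ⟨C, hCK⟩ := (Set.finite_range K).bddAbove
  refine ⟨S, max C 0, le_max_right _ _, fun s hs hsS => ?_⟩
  obtain ⟨a, ha, b, hb, hab, hd, hsab⟩ := exists_consecutive zero_mem one_mem hs
  have hmem : s ∈ Set.Ioo a b :=
    ⟨hsab.1.lt_of_ne fun h => hsS (h ▸ ha), hsab.2.lt_of_ne fun h => hsS (h ▸ hb)⟩
  obtain ⟨h_diff, h_le⟩ := hK ⟨(⟨a, ha⟩, ⟨b, hb⟩), hab, hd⟩ s hmem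
  exact ⟨h_diff, h_le.trans ((hCK ⟨_, rfl⟩).trans (le_max_left _ _))⟩

/-- A bound for the speed of a contour. -/
def Contour.speed (γ : Contour) : ℝ := γ.exists_deriv_bound.choose_spec.choose

theorem Contour.speed_nonneg (γ : Contour) : 0 ≤ γ.speed :=
  γ.exists_deriv_bound.choose_spec.choose_spec.1

open MeasureTheory in
theorem Contour.ae_norm_deriv_le (γ : Contour) :
    ∀ᵐ s ∂volume.restrict (Set.Ioc (0 : ℝ) 1), ‖deriv γ.toFun s‖ ≤ γ.speed := by
  have h := γ.exists_deriv_bound.choose_spec.choose_spec.2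
  have hS : (volume.restrict (Set.Ioc (0 : ℝ) 1)) (γ.exists_deriv_bound.choose : Set ℝ) = 0 :=
    (Finset.countable_toSet _).measure_zero _
  filter_upwards [ae_restrict_mem measurableSet_Ioc, compl_mem_ae_iff.2 hS] with s hs hsS
  exact (h s ⟨hs.1.le, hs.2⟩ hsS).2

/-- The contour as a continuous function on the unit interval. -/
def Contour.path (γ : Contour) : C(unitInterval, ℂ) where
  toFun s := γ.toFun s
  continuous_toFun := γ.continuousOn.domRestrict

theorem Contour.path_mem (γ : Contour) (s : unitInterval) : γ.path s ∈ γ.points := ⟨s, s.2, rfl⟩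

/-! ### Contour integrals of continuous functions -/

section ContourIntegral

open MeasureTheory

variable {V : Type*} [NormedAddCommGroup V]

/-- The continuous extension of `f` to `ℝ` which is constant outside `[0, 1]`. -/
abbrev extendI (f : C(unitInterval, V)) : C(ℝ, V) := f.IccExtend zero_le_one

theorem extendI_of_mem (f : C(unitInterval, V)) {s : ℝ} (hs : s ∈ Set.Icc (0 : ℝ) 1) :
    extendI f s = f ⟨s, hs⟩ :=
  Set.IccExtend_of_mem zero_le_one f hs

variable [NormedSpace ℂ V]

theorem intervalIntegrable_contour (γ : Contour) (f : C(unitInterval, V)) :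
    IntervalIntegrable (fun s => deriv γ.toFun s • extendI f s) volume 0 1 := by
  rw [intervalIntegrable_iff_integrableOn_Ioc_of_le zero_le_one]
  refine Integrable.of_bound (C := γ.speed * ‖f‖) ?_ ?_
  · exact ((measurable_deriv γ.toFun).aestronglyMeasurable).smul
      (extendI f).continuous.aestronglyMeasurable
  · filter_upwards [γ.ae_norm_deriv_le] with s hs
    rw [norm_smul]
    exact mul_le_mul hs (f.norm_coe_le_norm _) (norm_nonneg _) γ.speed_nonneg

/-- A bound for the length of the contour divided by `2 π`, through which every estimate of a
contour integral depends on the contour. -/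
def Contour.len (γ : Contour) : ℝ := ‖(2 * (Real.pi : ℂ) * Complex.I)⁻¹‖ * γ.speed

theorem Contour.len_nonneg (γ : Contour) : 0 ≤ γ.len :=
  mul_nonneg (norm_nonneg _) γ.speed_nonneg

theorem norm_integral_deriv_smul_le (γ : Contour) (f : C(unitInterval, V)) {K : ℝ}
    (hf : ∀ s, ‖f s‖ ≤ K) :
    ‖∫ s in (0 : ℝ)..1, deriv γ.toFun s • extendI f s‖ ≤ γ.speed * K := by
  have h_speed := γ.ae_norm_deriv_le
  rw [ae_restrict_iff' measurableSet_Ioc] at h_speed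
  refine (intervalIntegral.norm_integral_le_of_norm_le_const_ae (C := γ.speed * K) ?_).trans
    (by simp)
  filter_upwards [h_speed] with s hs hmem
  rw [Set.uIoc_of_le zero_le_one] at hmem
  rw [norm_smul]
  exact mul_le_mul (hs hmem) (hf _) (norm_nonneg _) γ.speed_nonneg

/-- The normalized contour integral `(2 i π)⁻¹ ∮ f`, as a continuous linear function of the
integrand; the latter is a function of the parameter in `[0, 1]`, not of the point on the curve. -/
def contourInt (γ : Contour) : C(unitInterval, V) →L[ℂ] V :=
  LinearMap.mkContinuous
    { toFun := fun f => (2 * (Real.pi : ℂ) * Complex.I)⁻¹ •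
        ∫ s in (0 : ℝ)..1, deriv γ.toFun s • extendI f s
      map_add' := fun f g => by
        rw [← smul_add, ← intervalIntegral.integral_add (intervalIntegrable_contour γ f)
          (intervalIntegrable_contour γ g)]
        congr 2 with s
        exact smul_add _ _ _
      map_smul' := fun c f => by
        rw [RingHom.id_apply, smul_comm c]
        congr 1
        rw [← intervalIntegral.integral_smul]
        congr 1 with s
        exact smul_comm _ _ _ } γ.len
    fun f => by
      rw [Contour.len, mul_assoc ‖_‖]
      exact (norm_smul_le _ _).trans (mul_le_mul_of_nonneg_left
        (norm_integral_deriv_smul_le γ f f.norm_coe_le_norm) (norm_nonneg _))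

theorem contourInt_apply (γ : Contour) (f : C(unitInterval, V)) :
    contourInt γ f = (2 * (Real.pi : ℂ) * Complex.I)⁻¹ •
      ∫ s in (0 : ℝ)..1, deriv γ.toFun s • extendI f s := rfl

theorem norm_contourInt_le (γ : Contour) (f : C(unitInterval, V)) {K : ℝ}
    (hf : ∀ s, ‖f s‖ ≤ K) : ‖contourInt γ f‖ ≤ γ.len * K := by
  rw [contourInt_apply, Contour.len, mul_assoc ‖_‖]
  exact (norm_smul_le _ _).trans (mul_le_mul_of_nonneg_left
    (norm_integral_deriv_smul_le γ f hf) (norm_nonneg _))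

theorem cauchyInt_eq_contourInt (γ : Contour) (F : ℂ → V) (f : C(unitInterval, V))
    (h : ∀ s, F (γ.path s) = f s) : cauchyInt γ.toFun F = contourInt γ f := by
  rw [cauchyInt, curveInt, contourInt_apply]
  congr 1
  refine intervalIntegral.integral_congr fun s hs => ?_
  rw [Set.uIcc_of_le zero_le_one] at hs
  simp only [extendI_of_mem f hs]
  rw [← h ⟨s, hs⟩]
  rfl

theorem map_contourInt {W : Type*} [NormedAddCommGroup W] [NormedSpace ℂ W] [CompleteSpace V]
    [CompleteSpace W] (γ : Contour) (Φ : V →L[ℂ] W) (f : C(unitInterval, V)) :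
    Φ (contourInt γ f) = contourInt γ ((Φ : C(V, W)).comp f) := by
  rw [contourInt_apply, contourInt_apply, map_smul]
  congr 1
  have h := Φ.intervalIntegral_comp_comm (intervalIntegrable_contour γ f)
  rw [← h]
  simp only [map_smul]
  rfl

theorem contourInt_eq_zero_of_hasDerivAt [CompleteSpace V] (γ : Contour) (F F' : ℂ → V)
    (hF : ∀ z ∈ γ.points, HasDerivAt F (F' z) z) (f : C(unitInterval, V))
    (hf : ∀ s, f s = F' (γ.path s)) : contourInt γ f = 0 := by
  obtain ⟨S, _, -, hS⟩ := γ.exists_deriv_bound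
  have h := integral_eq_of_hasDerivAt_off_countable (a := 0) (b := 1) (s := (S : Set ℝ))
    (fun s => F (γ.toFun s)) (fun s => deriv γ.toFun s • extendI f s) S.countable_toSet
    ?_ ?_ (intervalIntegrable_contour γ f)
  · rw [contourInt_apply, h, γ.closed, sub_self, smul_zero]
  · rw [Set.uIcc_of_le zero_le_one]
    exact ContinuousOn.comp (t := γ.points) (fun z hz => (hF z hz).continuousAt.continuousWithinAt)
      γ.continuousOn fun s hs => ⟨s, hs, rfl⟩
  · intro s hs
    rw [min_eq_left zero_le_one, max_eq_right zero_le_one] at hs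
    have hs' : s ∈ Set.Icc (0 : ℝ) 1 := ⟨hs.1.1.le, hs.1.2.le⟩
    rw [extendI_of_mem f hs', hf]
    exact (hF _ ⟨s, hs', rfl⟩).scomp s (hS s hs' hs.2).1.hasDerivAt

end ContourIntegral

/-! ### Resolvents along a contour -/

section Resolvent

variable {A : Type*} [NormedRing A] [NormedAlgebra ℂ A]

/-- The embedding of an algebra in its curves as the constant ones. -/
def constI : A →L[ℝ] C(unitInterval, A) := ContinuousLinearMap.const ℝ unitInterval

@[simp] theorem constI_apply (a : A) (s : unitInterval) : constI a s = a := rfl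

/-- The function `z ↦ z` along the contour. -/
def zetaI (A : Type*) [NormedRing A] [NormedAlgebra ℂ A] (γ : Contour) : C(unitInterval, A) where
  toFun s := algebraMap ℂ A (γ.path s)
  continuous_toFun := (continuous_algebraMap ℂ A).comp γ.path.continuous

@[simp] theorem zetaI_apply (γ : Contour) (s : unitInterval) :
    zetaI A γ s = algebraMap ℂ A (γ.path s) := rfl

/-- The resolvent `z ↦ (z - a)⁻¹` along the contour. -/
def resI (γ : Contour) (a : A) : C(unitInterval, A) := Ring.inverse (zetaI A γ - constI a)

theorem zetaI_commute (γ : Contour) (f : C(unitInterval, A)) : Commute (zetaI A γ) f := by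
  ext s
  exact Algebra.commutes _ _

/-- The contour does not meet the spectrum of `a`. -/
def Contour.Avoids (γ : Contour) (a : A) : Prop := ∀ z ∈ γ.points, z ∈ resolventSet ℂ a

variable [CompleteSpace A]

theorem Contour.Avoids.isUnit {γ : Contour} {a : A} (h : γ.Avoids a) :
    IsUnit (zetaI A γ - constI a) := by
  rw [ContinuousMap.isUnit_iff_forall_isUnit]
  exact fun s => h _ (γ.path_mem s)

theorem resI_mul {γ : Contour} {a : A} (h : γ.Avoids a) : resI γ a * (zetaI A γ - constI a) = 1 :=
  Ring.inverse_mul_cancel _ h.isUnit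

theorem mul_resI {γ : Contour} {a : A} (h : γ.Avoids a) : (zetaI A γ - constI a) * resI γ a = 1 :=
  Ring.mul_inverse_cancel _ h.isUnit

theorem resI_apply {γ : Contour} {a : A} (h : γ.Avoids a) (s : unitInterval) :
    resI γ a s = resolvent a (γ.path s) := by
  have h_inv : resI γ a s * (algebraMap ℂ A (γ.path s) - a) = 1 := congrArg (· s) (resI_mul h)
  exact (Ring.eq_mul_inverse_iff_mul_eq (resI γ a s) 1 _ (h _ (γ.path_mem s))).2 h_inv |>.trans
    (one_mul _)

theorem resI_sub_resI {γ : Contour} {a b : A} (ha : γ.Avoids a) (hb : γ.Avoids b) :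
    resI γ b - resI γ a = resI γ b * constI (b - a) * resI γ a := by
  have h : (constI (b - a) : C(unitInterval, A))
      = (zetaI A γ - constI a) - (zetaI A γ - constI b) := by
    rw [map_sub]; abel
  rw [h, mul_sub, sub_mul, resI_mul hb, one_mul, mul_assoc, mul_resI ha, mul_one]

theorem analyticAt_resI {γ : Contour} {a : A} (h : γ.Avoids a) :
    AnalyticAt ℝ (resI γ : A → C(unitInterval, A)) a := by
  have h_inverse : AnalyticAt ℝ (Ring.inverse : C(unitInterval, A) → C(unitInterval, A))
      (zetaI A γ - constI a) := analyticAt_inverse h.isUnit.unit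
  exact AnalyticAt.comp (f := fun x => zetaI A γ - constI x) h_inverse
    (analyticAt_const.sub ((constI : A →L[ℝ] C(unitInterval, A)).analyticAt a))

theorem hasFDerivAt_resI {γ : Contour} {a : A} (h : γ.Avoids a) :
    HasFDerivAt (𝕜 := ℝ) (resI γ : A → C(unitInterval, A))
      ((ContinuousLinearMap.mulLeftRight ℝ C(unitInterval, A) (resI γ a) (resI γ a)).comp constI)
      a := by
  have h_inner : HasFDerivAt (𝕜 := ℝ) (fun x : A => zetaI A γ - constI x) (-constI) a :=
    (constI : A →L[ℝ] C(unitInterval, A)).hasFDerivAt.const_sub (zetaI A γ)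
  have h_comp : HasFDerivAt (resI γ) _ a := HasFDerivAt.comp a (g := Ring.inverse)
    (hasFDerivAt_ringInverse (𝕜 := ℝ) h.isUnit.unit) h_inner
  have h_unit : (↑(h.isUnit.unit⁻¹) : C(unitInterval, A)) = resI γ a := by
    rw [resI, Ring.inverse_of_isUnit h.isUnit]
  rw [h_unit] at h_comp
  exact h_comp.congr_fderiv (by ext; simp)

/-! The next two identities are integrations by parts: `z R(z)` and `z R(z) k R(z)` have zero
integral after differentiation, because the contour is closed. -/

theorem contourInt_zetaI_mul_resI_sq {γ : Contour} {a : A} (h : γ.Avoids a) :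
    contourInt γ (zetaI A γ * (resI γ a * resI γ a)) = contourInt γ (resI γ a) := by
  rw [eq_comm, ← sub_eq_zero, ← map_sub]
  refine contourInt_eq_zero_of_hasDerivAt γ (fun z => z • resolvent a z)
    (fun z => resolvent a z + z • (-resolvent a z ^ 2)) (fun z hz => ?_) _ fun s => ?_
  · have h_deriv := (hasDerivAt_id z).smul (spectrum.hasDerivAt_resolvent_const_left (h z hz))
    exact h_deriv.congr_deriv (by simp only [id, one_smul]; rw [add_comm])
  · simp only [ContinuousMap.sub_apply, ContinuousMap.mul_apply, zetaI_apply, resI_apply h, sq,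
      Algebra.smul_def]
    noncomm_ring

theorem contourInt_resI_mul_mul_resI {γ : Contour} {a : A} (h : γ.Avoids a) (k : A) :
    contourInt γ (resI γ a * constI k * resI γ a)
      = contourInt γ (zetaI A γ * (resI γ a * resI γ a * constI k * resI γ a))
        + contourInt γ (zetaI A γ * (resI γ a * constI k * (resI γ a * resI γ a))) := by
  rw [← map_add, ← sub_eq_zero, ← map_sub]
  refine contourInt_eq_zero_of_hasDerivAt γ (fun z => z • (resolvent a z * k * resolvent a z))
    (fun z => resolvent a z * k * resolvent a z + z • (-resolvent a z ^ 2 * k * resolvent a z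
      + resolvent a z * k * -resolvent a z ^ 2)) (fun z hz => ?_) _ fun s => ?_
  · have h_res := spectrum.hasDerivAt_resolvent_const_left (h z hz)
    have h_deriv := (hasDerivAt_id z).smul ((h_res.mul_const k).mul h_res)
    exact h_deriv.congr_deriv (by simp only [id, one_smul, Pi.mul_apply]; rw [add_comm])
  · simp only [ContinuousMap.sub_apply, ContinuousMap.add_apply, ContinuousMap.mul_apply,
      zetaI_apply, resI_apply h, sq, Algebra.smul_def, constI_apply]
    noncomm_ring

end Resolvent

/-! ### Traces of contour integrals -/

instance instNormedRingOperatorCurves : NormedRing C(unitInterval, Hil →L[ℂ] Hil) := inferInstance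

section SeriesOfContourIntegrals

open MeasureTheory

variable {ι V : Type*} [NormedAddCommGroup V] [NormedSpace ℂ V] (γ : Contour)
  {f : ι → C(unitInterval, V)} {K : ℝ}

theorem sum_integral_norm_deriv_smul_le (hK : ∀ s : Finset ι, ∀ x, ∑ i ∈ s, ‖f i x‖ ≤ K)
    (s : Finset ι) :
    ∑ i ∈ s, ∫ x in Set.Ioc (0 : ℝ) 1, ‖deriv γ.toFun x • extendI (f i) x‖ ≤ γ.speed * K := by
  have h_int : ∀ i ∈ s, IntegrableOn (fun x => ‖deriv γ.toFun x • extendI (f i) x‖)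
      (Set.Ioc (0 : ℝ) 1) := fun i _ =>
    ((intervalIntegrable_iff_integrableOn_Ioc_of_le zero_le_one).1
      (intervalIntegrable_contour γ (f i))).norm
  rw [← integral_finsetSum s h_int]
  refine (integral_mono_ae (integrable_finsetSum s h_int)
    (integrable_const (γ.speed * K)) ?_).trans (by simp)
  filter_upwards [γ.ae_norm_deriv_le] with x hx
  simp only [norm_smul, ← Finset.mul_sum]
  exact mul_le_mul hx (hK s _) (Finset.sum_nonneg fun _ _ => norm_nonneg _) γ.speed_nonneg

theorem sum_norm_contourInt_le (hK : ∀ s : Finset ι, ∀ x, ∑ i ∈ s, ‖f i x‖ ≤ K)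
    (s : Finset ι) : ∑ i ∈ s, ‖contourInt γ (f i)‖ ≤ γ.len * K := by
  simp only [contourInt_apply, norm_smul, ← Finset.mul_sum, Contour.len, mul_assoc,
    intervalIntegral.integral_of_le (zero_le_one (α := ℝ))]
  exact mul_le_mul_of_nonneg_left ((Finset.sum_le_sum fun i _ => norm_integral_le_integral_norm _)
    |>.trans (sum_integral_norm_deriv_smul_le γ hK s)) (norm_nonneg _)

theorem hasSum_contourInt [Countable ι] {g : C(unitInterval, V)}
    (hK : ∀ s : Finset ι, ∀ x, ∑ i ∈ s, ‖f i x‖ ≤ K)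
    (hfg : ∀ x, HasSum (fun i => f i x) (g x)) :
    HasSum (fun i => contourInt γ (f i)) (contourInt γ g) := by
  simp only [contourInt_apply, intervalIntegral.integral_of_le (zero_le_one (α := ℝ))]
  refine HasSum.const_smul _ ?_
  have h_sum := hasSum_integral_of_summable_integral_norm
    (μ := volume.restrict (Set.Ioc (0 : ℝ) 1))
    (F := fun i x => deriv γ.toFun x • extendI (f i) x)
    (fun i => (intervalIntegrable_iff_integrableOn_Ioc_of_le zero_le_one).1
      (intervalIntegrable_contour γ (f i)))
    (summable_of_sum_le (fun i => integral_nonneg fun x => norm_nonneg _)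
      (sum_integral_norm_deriv_smul_le γ hK))
  have h_tsum (x : ℝ) : ∑' i, deriv γ.toFun x • extendI (f i) x = deriv γ.toFun x • extendI g x :=
    ((hfg (Set.projIcc 0 1 zero_le_one x)).const_smul (deriv γ.toFun x)).tsum_eq
  simpa only [h_tsum] using h_sum

end SeriesOfContourIntegrals

section TraceContour

/-- The diagonal matrix coefficient `X ↦ ⟪e m, X (e m)⟫`. -/
def diagCoeff (m : ℤ) : (Hil →L[ℂ] Hil) →L[ℂ] ℂ :=
  (innerSL ℂ (e m)).comp (ContinuousLinearMap.apply ℂ Hil (e m))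

theorem inner_e_contourInt (γ : Contour) (m : ℤ) (f : C(unitInterval, Hil →L[ℂ] Hil)) :
    inner ℂ (e m) (contourInt γ f (e m))
      = contourInt γ ((diagCoeff m : C(Hil →L[ℂ] Hil, ℂ)).comp f) :=
  map_contourInt γ (diagCoeff m) f

theorem mul_contourInt {A : Type*} [NormedRing A] [NormedAlgebra ℂ A] [CompleteSpace A]
    (γ : Contour) (b : A) (f : C(unitInterval, A)) :
    b * contourInt γ f = contourInt γ (constI b * f) :=
  map_contourInt γ (ContinuousLinearMap.mul ℂ A b) f

theorem hopTrace_contourInt (γ : Contour) (h : L1) (f : C(unitInterval, Hil →L[ℂ] Hil)) :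
    hopTrace h (contourInt γ f)
      = contourInt γ ((hopTraceC h : C(Hil →L[ℂ] Hil, ℂ)).comp f) :=
  map_contourInt γ (hopTraceC h) f

variable (γ : Contour) (h : L1) (A C : C(unitInterval, Hil →L[ℂ] Hil))

theorem sum_norm_diagCoeff_le (s : Finset ℤ) (x : unitInterval) :
    ∑ m ∈ s, ‖(diagCoeff m : C(Hil →L[ℂ] Hil, ℂ)).comp (A * constI (hop h) * C) x‖
      ≤ ‖A‖ * ‖C‖ * (2 * ‖h‖) := by
  obtain ⟨u, v, hN, h_le⟩ := exists_hasNuclearExpansion_hop h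
  refine (hN.sum_norm_inner_mul_mul_le (A x) (C x) s).trans ?_
  have hA := A.norm_coe_le_norm x
  have hC := C.norm_coe_le_norm x
  gcongr

theorem isTraceClass_contourInt : IsTraceClass (contourInt γ (A * constI (hop h) * C)) := by
  refine isTraceClass_of_sum_norm_inner_le (K := γ.len * (‖A‖ * ‖C‖ * (2 * ‖h‖)))
    fun B hB s => ?_
  have hBA : ‖constI B * A‖ ≤ ‖A‖ := (norm_mul_le _ _).trans (mul_le_of_le_one_left
    (norm_nonneg _) ((ContinuousMap.norm_le _ zero_le_one).2 fun _ => hB))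
  simp only [mul_contourInt, ← mul_assoc, inner_e_contourInt]
  refine (sum_norm_contourInt_le γ (sum_norm_diagCoeff_le h (constI B * A) C) s).trans ?_
  have := γ.len_nonneg
  simp only [mul_assoc]
  gcongr

theorem hasSum_inner_contourInt :
    HasSum (fun m => inner ℂ (e m) (contourInt γ (A * constI (hop h) * C) (e m)))
      (hopTrace h (contourInt γ (C * A))) := by
  simp only [inner_e_contourInt, hopTrace_contourInt]
  refine hasSum_contourInt γ (sum_norm_diagCoeff_le h A C) fun x => ?_
  obtain ⟨u, v, hN, -⟩ := exists_hasNuclearExpansion_hop h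
  have h_sum := (hN.mul_mul (A x) (C x)).hasSum_inner_apply
  rwa [trace_mul_hop_mul] at h_sum

theorem trace_contourInt :
    trace (contourInt γ (A * constI (hop h) * C)) = hopTrace h (contourInt γ (C * A)) :=
  (hasSum_inner_contourInt γ h A C).tsum_eq

theorem hopTrace_contourInt_comm (k : L1) :
    hopTrace k (contourInt γ (A * constI (hop h) * C))
      = hopTrace h (contourInt γ (C * constI (hop k) * A)) := by
  have h_left := trace_contourInt γ k 1 (A * constI (hop h) * C)
  have h_right := trace_contourInt γ h (constI (hop k) * A) C
  rw [mul_one] at h_left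
  rw [← h_left, mul_assoc C, ← h_right]
  simp only [one_mul, mul_assoc]

theorem norm_hopTrace_contourInt_le (k : L1) :
    ‖hopTrace k (contourInt γ (A * constI (hop h) * C))‖
      ≤ γ.len * (4 * ‖A‖ * ‖C‖ * ‖toL2 k‖ * ‖toL2 h‖) := by
  rw [hopTrace_contourInt]
  refine norm_contourInt_le γ _ fun s => ?_
  refine (norm_hopTrace_mul_hop_mul_le k h (A s) (C s)).trans ?_
  have hA := A.norm_coe_le_norm s
  have hC := C.norm_coe_le_norm s
  gcongr

end TraceContour

/-! ### Resolvent expansions -/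

section ResolventExpansion

variable {A : Type*} [NormedRing A] [NormedAlgebra ℂ A]

/-- The normalized contour integral as a continuous real linear map. -/
def contourIntR (γ : Contour) : C(unitInterval, A) →L[ℝ] A := (contourInt γ).restrictScalars ℝ

@[simp] theorem contourIntR_apply (γ : Contour) (f : C(unitInterval, A)) :
    contourIntR γ f = contourInt γ f := rfl

variable [CompleteSpace A] {E : Type*} [NormedAddCommGroup E] [NormedSpace ℝ E]
  {γ : Contour} {a b : A}

theorem cauchyInt_smul_resolvent (ha : γ.Avoids a) :
    cauchyInt γ.toFun (fun z => z • resolvent a z) = contourInt γ (zetaI A γ * resI γ a) :=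
  cauchyInt_eq_contourInt γ _ _ fun s => by
    rw [ContinuousMap.mul_apply, resI_apply ha, zetaI_apply, Algebra.smul_def]

theorem resI_sub_resI' (ha : γ.Avoids a) (hb : γ.Avoids b) :
    resI γ b - resI γ a = resI γ a * constI (b - a) * resI γ b := by
  have h_sub : constI (b - a) = (zetaI A γ - constI a) - (zetaI A γ - constI b) := by
    rw [map_sub]
    abel
  rw [h_sub, mul_sub, sub_mul, resI_mul ha, one_mul, mul_assoc, mul_resI hb, mul_one]

theorem resI_expansion (ha : γ.Avoids a) (hb : γ.Avoids b) :
    resI γ b = resI γ a + resI γ a * constI (b - a) * resI γ a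
      + resI γ a * constI (b - a) * (resI γ a * constI (b - a) * resI γ b) := by
  have h_first := sub_eq_iff_eq_add'.1 (resI_sub_resI' ha hb)
  calc resI γ b = resI γ a + resI γ a * constI (b - a) * resI γ b := h_first
    _ = resI γ a + resI γ a * constI (b - a) *
          (resI γ a + resI γ a * constI (b - a) * resI γ b) :=
        congrArg _ (congrArg _ h_first)
    _ = _ := by rw [mul_add, ← add_assoc]

theorem contourInt_expansion (ha : γ.Avoids a) (hb : γ.Avoids b) :
    contourInt γ (resI γ a * zetaI A γ * resI γ b) = contourInt γ (resI γ a)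
      + contourInt γ (zetaI A γ * (resI γ a * resI γ a) * constI (b - a) * resI γ a)
      + contourInt γ (zetaI A γ * (resI γ a * resI γ a) * constI (b - a)
          * (resI γ a * constI (b - a) * resI γ b)) := by
  rw [← contourInt_zetaI_mul_resI_sq ha, ← map_add, ← map_add, ← (zetaI_commute γ (resI γ a)).eq]
  congr 1
  conv_lhs => rw [resI_expansion ha hb]
  simp only [mul_add, mul_assoc]

/-- The function `h ↦ (2 i π)⁻¹ ∮ c(z) (z - a - K h)⁻¹ dz`. -/
def resInt (γ : Contour) (c : C(unitInterval, A)) (a : A) (K : E →L[ℝ] A) (h : E) : A :=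
  contourIntR γ (c * resI γ (a + K h))

variable {K : E →L[ℝ] A} {h : E}

theorem analyticAt_resInt (c : C(unitInterval, A)) (ha : γ.Avoids (a + K h)) :
    AnalyticAt ℝ (resInt γ c a K) h := by
  have h_res : AnalyticAt ℝ (fun h => resI γ (a + K h)) h :=
    AnalyticAt.comp (f := fun h => a + K h) (analyticAt_resI ha)
      (analyticAt_const.add (K.analyticAt h))
  have h_int := ((contourIntR γ).comp
    (ContinuousLinearMap.mul ℝ C(unitInterval, A) c)).analyticAt (resI γ (a + K h))
  exact AnalyticAt.comp (f := fun h => resI γ (a + K h)) h_int h_res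

theorem hasFDerivAt_resInt (ha : γ.Avoids (a + K h)) :
    HasFDerivAt (resInt γ 1 a K) ((contourIntR γ).comp
      ((ContinuousLinearMap.mulLeftRight ℝ C(unitInterval, A) (resI γ (a + K h))
        (resI γ (a + K h))).comp (constI.comp K))) h := by
  have h_res : HasFDerivAt (fun h => resI γ (a + K h)) _ h :=
    HasFDerivAt.comp (f := fun h => a + K h) h (hasFDerivAt_resI ha) (K.hasFDerivAt.const_add a)
  have h_eq : resInt γ 1 a K = contourIntR γ ∘ fun h => resI γ (a + K h) := by
    funext h
    rw [resInt, one_mul, Function.comp_apply]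
  rw [h_eq]
  exact (contourIntR γ).hasFDerivAt.comp h h_res

end ResolventExpansion

/-! ### The trace of `(T + H)_- - T_-` -/

section Adapted

variable {t : ℤ → ℝ} {γ : Contour} {η : ℝ} {h k : L1}

namespace IsAdapted

theorem norm_zero_le (hA : IsAdapted t γ η) : ‖(0 : L1)‖ ≤ η := by
  rw [norm_zero]
  exact hA.1.le

theorem avoids (hA : IsAdapted t γ η) (hh : ‖h‖ ≤ η) : γ.Avoids (hop t + hopL h) := by
  obtain ⟨-, C, -, hC⟩ := hA
  exact fun z hz => ((hC h fun n => (h.abs_apply_le n).trans hh).1 z hz).1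

theorem avoids_zero (hA : IsAdapted t γ η) : γ.Avoids (hop t) := by
  simpa only [map_zero, add_zero] using hA.avoids hA.norm_zero_le

theorem exists_norm_resI_le (hA : IsAdapted t γ η) :
    ∃ C, 0 ≤ C ∧ ∀ h : L1, ‖h‖ ≤ η → ‖resI γ (hop t + hopL h)‖ ≤ C := by
  have h_avoids (h : L1) := hA.avoids (h := h)
  obtain ⟨-, C, hC_nonneg, hC⟩ := hA
  refine ⟨C, hC_nonneg, fun h hh => (ContinuousMap.norm_le _ hC_nonneg).2 fun s => ?_⟩
  rw [resI_apply (h_avoids h hh)]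
  exact ((hC h fun n => (h.abs_apply_le n).trans hh).1 _ (γ.path_mem s)).2

theorem negPart_eq (hA : IsAdapted t γ η) (hh : ‖h‖ ≤ η) :
    negPart (hop t + hopL h) = -contourInt γ (zetaI _ γ * resI γ (hop t + hopL h)) := by
  have h_avoids := hA.avoids hh
  obtain ⟨-, C, -, hC⟩ := hA
  rw [← neg_eq_iff_eq_neg, ← cauchyInt_smul_resolvent h_avoids]
  exact (hC h fun n => (h.abs_apply_le n).trans hh).2

theorem negPart_sub (hA : IsAdapted t γ η) (hh : ‖h‖ ≤ η) (hk : ‖k‖ ≤ η) :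
    negPart (hop t + hopL k) - negPart (hop t + hopL h)
      = -contourInt γ (zetaI _ γ * resI γ (hop t + hopL k) * constI (hop (k - h : L1))
          * resI γ (hop t + hopL h)) := by
  have h_res := resI_sub_resI (hA.avoids hh) (hA.avoids hk)
  have h_hop : hop t + hopL k - (hop t + hopL h) = hop (k - h : L1) := by
    rw [add_sub_add_left_eq_sub, ← map_sub, hopL_apply]
  rw [h_hop] at h_res
  rw [hA.negPart_eq hh, hA.negPart_eq hk, mul_assoc, mul_assoc, ← mul_assoc (resI _ _), ← h_res,
    mul_sub, map_sub]
  abel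

theorem isTraceClass (hA : IsAdapted t γ η) (hh : ‖h‖ ≤ η) :
    IsTraceClass (negPart (hop t + hop h) - negPart (hop t)) := by
  have h_sub := hA.negPart_sub hA.norm_zero_le hh
  simp only [map_zero, add_zero] at h_sub
  rw [← hopL_apply, h_sub]
  exact (isTraceClass_contourInt _ _ _ _).neg

end IsAdapted

/-- The function `h ↦ (2 i π)⁻¹ ∮ z (z - T - H₀)⁻¹ (z - T - H)⁻¹ dz`, which represents the increment
of `h ↦ -Tr ((T + H)_- - T_-)` between `h₀` and `h`. -/
def chordInt (t : ℤ → ℝ) (γ : Contour) (h₀ h : L1) : Hil →L[ℂ] Hil :=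
  resInt γ (resI γ (hop t + hopL h₀) * zetaI _ γ) (hop t) hopL h

/-- The trace of `(T + H)_- - T_-`. -/
def traceDiff (t : ℤ → ℝ) (h : L1) : ℂ := trace (negPart (hop t + hopL h) - negPart (hop t))

/-- The differential at `h` of `h ↦ -Tr ((T + H)_- - T_-)`. -/
def slope (t : ℤ → ℝ) (γ : Contour) (h : L1) : L1 →L[ℝ] ℂ :=
  hopTrace.flip (resInt γ 1 (hop t) hopL h)

/-- The differential at `h` of `slope t γ`. -/
def slopeDeriv (t : ℤ → ℝ) (γ : Contour) (h : L1) : L1 →L[ℝ] L1 →L[ℝ] ℂ :=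
  hopTrace.flip.comp ((contourIntR γ).comp
    ((ContinuousLinearMap.mulLeftRight ℝ C(unitInterval, Hil →L[ℂ] Hil)
      (resI γ (hop t + hopL h)) (resI γ (hop t + hopL h))).comp (constI.comp hopL)))

theorem slope_apply (h k : L1) :
    slope t γ h k = hopTrace k (contourInt γ (resI γ (hop t + hopL h))) := by
  rw [slope, ContinuousLinearMap.flip_apply, resInt, one_mul, contourIntR_apply]

theorem slope_zero_apply (k : L1) :
    slope t γ 0 k = hopTrace k (contourInt γ (resI γ (hop t))) := by
  rw [slope_apply, map_zero, add_zero]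

theorem slopeDeriv_zero_apply (h k : L1) :
    slopeDeriv t γ 0 h k
      = hopTrace h (contourInt γ (resI γ (hop t) * constI (hop k) * resI γ (hop t))) := by
  rw [← hopTrace_contourInt_comm, ← add_zero (hop t), ← map_zero hopL]
  rfl

theorem slopeDeriv_zero_self (hA : γ.Avoids (hop t)) (h : L1) :
    slopeDeriv t γ 0 h h = 2 * hopTrace h (contourInt γ
      (zetaI _ γ * (resI γ (hop t) * resI γ (hop t)) * constI (hop h) * resI γ (hop t))) := by
  let r := resI γ (hop t)
  have h_comm : zetaI _ γ * (r * constI (hop h) * (r * r))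
      = r * constI (hop h) * (zetaI _ γ * (r * r)) := by
    rw [← mul_assoc, (zetaI_commute γ (r * constI (hop h))).eq, mul_assoc]
  rw [slopeDeriv_zero_apply, contourInt_resI_mul_mul_resI hA, h_comm, map_add,
    hopTrace_contourInt_comm γ h r (zetaI _ γ * (r * r)) h, two_mul]
  simp only [r, mul_assoc]

namespace IsAdapted

theorem hasSum_inner_negPart_sub (hA : IsAdapted t γ η) (hh : ‖h‖ ≤ η) (hk : ‖k‖ ≤ η) :
    HasSum (fun m => inner ℂ (e m) ((negPart (hop t + hopL k) - negPart (hop t + hopL h)) (e m)))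
      (-hopTrace (k - h) (chordInt t γ h k)) := by
  rw [hA.negPart_sub hh hk]
  have h_sum := (hasSum_inner_contourInt γ (k - h) (zetaI _ γ * resI γ (hop t + hopL k))
    (resI γ (hop t + hopL h))).neg
  rw [← mul_assoc] at h_sum
  simp only [neg_apply, inner_neg_right]
  exact h_sum

theorem traceDiff_sub (hA : IsAdapted t γ η) (hh : ‖h‖ ≤ η) (hk : ‖k‖ ≤ η) :
    traceDiff t k = traceDiff t h - hopTrace (k - h) (chordInt t γ h k) := by
  have h_first := hA.hasSum_inner_negPart_sub hA.norm_zero_le hh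
  have h_total := h_first.add (hA.hasSum_inner_negPart_sub hh hk)
  simp only [map_zero, add_zero, ← inner_add_right, ← add_apply] at h_first h_total
  rw [traceDiff, traceDiff, trace, trace, h_first.tsum_eq,
    sub_eq_add_neg _ (hopTrace _ _), ← h_total.tsum_eq]
  refine tsum_congr fun m => ?_
  congr 3
  abel

theorem traceDiff_eq (hA : IsAdapted t γ η) (hh : ‖h‖ ≤ η) :
    traceDiff t h = -hopTrace h (chordInt t γ 0 h) := by
  have h_zero : traceDiff t 0 = 0 := by
    rw [traceDiff, map_zero, add_zero, sub_self]
    simp [trace]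
  rw [hA.traceDiff_sub hA.norm_zero_le hh, h_zero, sub_zero, zero_sub]

theorem chordInt_self (hA : IsAdapted t γ η) (hh : ‖h‖ ≤ η) :
    chordInt t γ h h = resInt γ 1 (hop t) hopL h := by
  rw [chordInt, resInt, resInt, one_mul, contourIntR_apply, contourIntR_apply,
    ← contourInt_zetaI_mul_resI_sq (hA.avoids hh), (zetaI_commute γ _).symm.eq, mul_assoc]

theorem hasFDerivAt_traceDiff (hA : IsAdapted t γ η) (hh : ‖h‖ < η) :
    HasFDerivAt (traceDiff t) (-slope t γ h) h := by
  have h_chord : DifferentiableAt ℝ (chordInt t γ h) h :=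
    (analyticAt_resInt _ (hA.avoids hh.le)).differentiableAt
  have h_deriv := (hopTrace.hasFDerivAt_of_bilinear ((hasFDerivAt_id h).sub_const h)
    h_chord.hasFDerivAt).const_sub (traceDiff t h)
  have h_eq : traceDiff t =ᶠ[nhds h]
      fun k => traceDiff t h - hopTrace (k - h) (chordInt t γ h k) := by
    filter_upwards [Metric.isOpen_ball.mem_nhds (mem_ball_zero_iff.2 hh)] with k hk
    exact hA.traceDiff_sub hh.le (mem_ball_zero_iff.1 hk).le
  refine (h_deriv.congr_of_eventuallyEq h_eq).congr_fderiv ?_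
  ext k
  simp [slope, hA.chordInt_self hh.le]

theorem hasFDerivAt_slope (hA : IsAdapted t γ η) (hh : ‖h‖ ≤ η) :
    HasFDerivAt (slope t γ) (slopeDeriv t γ h) h :=
  hopTrace.flip.hasFDerivAt.comp h (hasFDerivAt_resInt (hA.avoids hh))

theorem hopTrace_chordInt (hA : IsAdapted t γ η) (hh : ‖h‖ ≤ η) :
    hopTrace h (chordInt t γ 0 h) = slope t γ 0 h + 1 / 2 * slopeDeriv t γ 0 h h
      + hopTrace h (contourInt γ (zetaI _ γ * (resI γ (hop t) * resI γ (hop t)) * constI (hop h)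
          * (resI γ (hop t) * constI (hop h) * resI γ (hop t + hopL h)))) := by
  have h_expansion := contourInt_expansion hA.avoids_zero (hA.avoids hh)
  rw [add_sub_cancel_left, hopL_apply] at h_expansion
  rw [chordInt, resInt, contourIntR_apply, slope_zero_apply, slopeDeriv_zero_self hA.avoids_zero,
    map_zero, add_zero, hopL_apply, h_expansion, map_add, map_add]
  ring

end IsAdapted

end Adapted

/-! ### Reality of the differentials -/

theorem isSelfAdjoint_negPart (A : Hil →L[ℂ] Hil) : IsSelfAdjoint (negPart A) :=
  (CFC.negPart_nonneg A).isSelfAdjoint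

theorem traceDiff_im (t : ℤ → ℝ) (h : L1) : (traceDiff t h).im = 0 :=
  trace_im_eq_zero ((isSelfAdjoint_negPart _).sub (isSelfAdjoint_negPart _))

namespace IsAdapted

variable {t : ℤ → ℝ} {γ : Contour} {η : ℝ}

/-! The contour need not be symmetric under conjugation, so the reality of the two forms is read off
from that of the function they differentiate. -/

theorem slope_im (hA : IsAdapted t γ η) {h : L1} (hh : ‖h‖ < η) (k : L1) :
    (slope t γ h k).im = 0 := by
  have h_deriv := Complex.imCLM.hasFDerivAt.comp h (hA.hasFDerivAt_traceDiff hh)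
  have h_zero : Complex.imCLM ∘ traceDiff t = fun _ => 0 := funext fun h => traceDiff_im t h
  rw [h_zero] at h_deriv
  simpa using congrArg (· k) (h_deriv.unique (hasFDerivAt_const (0 : ℝ) h))

theorem slopeDeriv_zero_im (hA : IsAdapted t γ η) (h k : L1) :
    (slopeDeriv t γ 0 h k).im = 0 := by
  have h_deriv := (ContinuousLinearMap.compL ℝ L1 ℂ ℝ Complex.imCLM).hasFDerivAt.comp 0
    (hA.hasFDerivAt_slope hA.norm_zero_le)
  have h_zero : (fun _ => 0) =ᶠ[nhds 0]
      (ContinuousLinearMap.compL ℝ L1 ℂ ℝ Complex.imCLM) ∘ slope t γ := by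
    filter_upwards [Metric.ball_mem_nhds (0 : L1) hA.1] with k hk
    ext h
    exact (hA.slope_im (mem_ball_zero_iff.1 hk) h).symm
  have h_unique := (h_deriv.congr_of_eventuallyEq h_zero).unique (hasFDerivAt_const _ _)
  exact congrArg (fun f => f h k) h_unique

end IsAdapted

/-! ### The energy difference -/

/-- The form `(h, k) ↦ ∑ h n * k n` on `ℓ¹`. -/
def dotForm : L1 →L[ℝ] L1 →L[ℝ] ℝ := (innerSL ℝ).bilinearComp toL2L toL2L

theorem dotForm_apply (h k : L1) : dotForm h k = inner ℝ (toL2 h) (toL2 k) := rfl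

theorem dotForm_comm (h k : L1) : dotForm h k = dotForm k h := by
  rw [dotForm_apply, dotForm_apply, real_inner_comm]

theorem hasSum_dotForm (h k : L1) : HasSum (fun n => h n * k n) (dotForm h k) := by
  have h_sum := lp.hasSum_inner (𝕜 := ℝ) (toL2 h) (toL2 k)
  simp only [toL2_apply, RCLike.inner_apply, conj_trivial] at h_sum
  simpa only [mul_comm, dotForm_apply] using h_sum

theorem norm_dotForm_le (h k : L1) : ‖dotForm h k‖ ≤ ‖toL2 h‖ * ‖toL2 k‖ := by
  rw [dotForm_apply]
  exact norm_inner_le_norm _ _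

/-- The linear form `h ↦ ∑ b n * h n` on `ℓ¹` attached to a bounded sequence `b`. -/
def boundedForm (b : ℤ → ℝ) {M : ℝ} (hb : ∀ n, ‖b n‖ ≤ M) : L1 →L[ℝ] ℝ :=
  LinearMap.mkContinuous
    { toFun := fun h => ∑' n, h n • b n
      map_add' := fun h k => by
        rw [← (h.summable_smul_and_norm_tsum_le hb).1.tsum_add
          (k.summable_smul_and_norm_tsum_le hb).1]
        exact tsum_congr fun n => add_smul (h n) (k n) _
      map_smul' := fun c h => by
        rw [RingHom.id_apply, ← (h.summable_smul_and_norm_tsum_le hb).1.tsum_const_smul]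
        exact tsum_congr fun n => mul_smul c (h n) _ }
    M fun h => (h.summable_smul_and_norm_tsum_le hb).2

theorem hasSum_boundedForm (b : ℤ → ℝ) {M : ℝ} (hb : ∀ n, ‖b n‖ ≤ M) (h : L1) :
    HasSum (fun n => b n * h n) (boundedForm b hb h) := by
  have h_sum : HasSum (fun n => h n • b n) (boundedForm b hb h) :=
    (h.summable_smul_and_norm_tsum_le hb).1.hasSum
  simpa only [smul_eq_mul, mul_comm] using h_sum

section Energy

variable {μ : ℝ} {t : ℤ → ℝ} {γ : Contour} {η M : ℝ} (hb : ∀ n, ‖t n - 1‖ ≤ M)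

theorem energyDiff_eq (h : L1) :
    energyDiff μ t h = μ / 2 * dotForm h h + μ * boundedForm (fun n => t n - 1) hb h
      - 2 * (traceDiff t h).re := by
  have h_sum := (hasSum_dotForm h h).add ((hasSum_boundedForm _ hb h).mul_left 2)
  have h_tsum : ∑' n : ℤ, (h n + 2 * t n - 2) * h n
      = dotForm h h + 2 * boundedForm (fun n => t n - 1) hb h := by
    rw [← h_sum.tsum_eq]
    exact tsum_congr fun n => by ring
  rw [energyDiff, h_tsum, traceDiff, hopL_apply]
  ring

/-- The expression of the energy difference by a contour integral. Unlike `energyDiff`, it is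
analytic on a neighbourhood of the closed ball of an adapted radius. -/
def contourEnergy (μ : ℝ) (γ : Contour) (hb : ∀ n, ‖t n - 1‖ ≤ M) (h : L1) : ℝ :=
  μ / 2 * dotForm h h + μ * boundedForm (fun n => t n - 1) hb h
    + 2 * (hopTrace h (chordInt t γ 0 h)).re

/-- The differential of the energy difference at `h`. -/
def energyDeriv (μ : ℝ) (γ : Contour) (hb : ∀ n, ‖t n - 1‖ ≤ M) (h : L1) : L1 →L[ℝ] ℝ :=
  μ • dotForm h + μ • boundedForm (fun n => t n - 1) hb
    + (2 : ℝ) • ContinuousLinearMap.compL ℝ L1 ℂ ℝ Complex.reCLM (slope t γ h)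

/-- The Hessian of the energy difference at `0`. -/
def energyHess (μ : ℝ) (t : ℤ → ℝ) (γ : Contour) : L1 →L[ℝ] L1 →L[ℝ] ℝ :=
  μ • dotForm
    + (2 : ℝ) • (ContinuousLinearMap.compL ℝ L1 ℂ ℝ Complex.reCLM).comp (slopeDeriv t γ 0)

theorem energyDeriv_zero_apply (h : L1) :
    energyDeriv μ γ hb 0 h
      = μ * boundedForm (fun n => t n - 1) hb h + 2 * (slope t γ 0 h).re := by
  simp [energyDeriv]

theorem energyHess_apply (h k : L1) :
    energyHess μ t γ h k = μ * dotForm h k + 2 * (slopeDeriv t γ 0 h k).re := rfl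

namespace IsAdapted

theorem energyDiff_eq_contourEnergy (hA : IsAdapted t γ η) {h : L1} (hh : ‖h‖ ≤ η) :
    energyDiff μ t h = contourEnergy μ γ hb h := by
  rw [energyDiff_eq hb, hA.traceDiff_eq hh, contourEnergy, Complex.neg_re]
  ring

theorem analyticAt_contourEnergy (hA : IsAdapted t γ η) {h : L1} (hh : ‖h‖ ≤ η) :
    AnalyticAt ℝ (contourEnergy μ γ hb) h := by
  have h_dot : AnalyticAt ℝ (fun h : L1 => dotForm h h) h :=
    AnalyticAt.comp (f := fun h : L1 => (h, h)) (dotForm.analyticAt_bilinear (h, h))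
      (analyticAt_id.prod analyticAt_id)
  have h_chord : AnalyticAt ℝ (chordInt t γ 0) h := analyticAt_resInt _ (hA.avoids hh)
  have h_trace : AnalyticAt ℝ (fun h : L1 => hopTrace h (chordInt t γ 0 h)) h :=
    AnalyticAt.comp (f := fun h : L1 => (h, chordInt t γ 0 h))
      (hopTrace.analyticAt_bilinear (h, chordInt t γ 0 h)) (analyticAt_id.prod h_chord)
  have h_re : AnalyticAt ℝ (fun h : L1 => (hopTrace h (chordInt t γ 0 h)).re) h :=
    AnalyticAt.comp (f := fun h : L1 => hopTrace h (chordInt t γ 0 h))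
      (Complex.reCLM.analyticAt _) h_trace
  exact ((analyticAt_const.mul h_dot).add (analyticAt_const.mul
    ((boundedForm (fun n => t n - 1) hb).analyticAt h))).add (analyticAt_const.mul h_re)

theorem contDiffOn_energyDiff (hA : IsAdapted t γ η) (hb : ∀ n, ‖t n - 1‖ ≤ M) :
    ContDiffOn ℝ ∞ (energyDiff μ t) (Metric.closedBall 0 η) := by
  have h_eq : ∀ h ∈ Metric.closedBall (0 : L1) η, energyDiff μ t h = contourEnergy μ γ hb h :=
    fun h hh => hA.energyDiff_eq_contourEnergy hb (mem_closedBall_zero_iff.1 hh)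
  have h_smooth : ContDiffOn ℝ ∞ (contourEnergy μ γ hb) (Metric.closedBall 0 η) := fun h hh =>
    (hA.analyticAt_contourEnergy hb (mem_closedBall_zero_iff.1 hh)).contDiffAt.contDiffWithinAt
  exact h_smooth.congr h_eq

theorem analyticOnNhd_energyDiff (hA : IsAdapted t γ η) (hb : ∀ n, ‖t n - 1‖ ≤ M) :
    AnalyticOnNhd ℝ (energyDiff μ t) (Metric.ball 0 η) := by
  intro h hh
  refine (hA.analyticAt_contourEnergy (μ := μ) hb (mem_ball_zero_iff.1 hh).le).congr ?_
  filter_upwards [Metric.isOpen_ball.mem_nhds hh] with k hk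
  exact (hA.energyDiff_eq_contourEnergy hb (mem_ball_zero_iff.1 hk).le).symm

theorem hasFDerivAt_energyDiff (hA : IsAdapted t γ η) {h : L1} (hh : ‖h‖ < η) :
    HasFDerivAt (energyDiff μ t) (energyDeriv μ γ hb h) h := by
  have h_dot := dotForm.hasFDerivAt_of_bilinear (hasFDerivAt_id h) (hasFDerivAt_id h)
  have h_trace := Complex.reCLM.hasFDerivAt.comp h (hA.hasFDerivAt_traceDiff hh)
  have h_sum := ((h_dot.const_mul (μ / 2)).add
    ((boundedForm (fun n => t n - 1) hb).hasFDerivAt.const_mul μ)).sub (h_trace.const_mul 2)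
  have h_eq : energyDiff μ t = fun h => μ / 2 * dotForm h h +
      μ * boundedForm (fun n => t n - 1) hb h - 2 * (traceDiff t h).re :=
    funext fun h => energyDiff_eq hb h
  rw [h_eq]
  refine h_sum.congr_fderiv ?_
  ext k
  simp [energyDeriv, dotForm_comm k h]
  ring

theorem hasFDerivAt_fderiv_energyDiff (hA : IsAdapted t γ η) (hb : ∀ n, ‖t n - 1‖ ≤ M) :
    HasFDerivAt (fderiv ℝ (energyDiff μ t)) (energyHess μ t γ) 0 := by
  have h_slope := (ContinuousLinearMap.compL ℝ L1 ℂ ℝ Complex.reCLM).hasFDerivAt.comp 0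
    (hA.hasFDerivAt_slope hA.norm_zero_le)
  have h_deriv : HasFDerivAt (energyDeriv μ γ hb) (energyHess μ t γ) 0 :=
    ((μ • dotForm).hasFDerivAt.add_const _).add (h_slope.const_smul (2 : ℝ))
  refine h_deriv.congr_of_eventuallyEq ?_
  filter_upwards [Metric.ball_mem_nhds (0 : L1) hA.1] with k hk
  exact (hA.hasFDerivAt_energyDiff hb (mem_ball_zero_iff.1 hk)).fderiv

theorem ofReal_energyDeriv_zero (hA : IsAdapted t γ η) (h : L1) :
    (energyDeriv μ γ hb 0 h : ℂ)
      = ((μ * ∑' n : ℤ, (t n - 1) * h n : ℝ) : ℂ) + 2 * slope t γ 0 h := by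
  have h_re : ((slope t γ 0 h).re : ℂ) = slope t γ 0 h :=
    Complex.conj_eq_iff_re.1 (Complex.conj_eq_iff_im.2
      (hA.slope_im (norm_zero.trans_lt hA.1) h))
  rw [energyDeriv_zero_apply, (hasSum_boundedForm _ hb h).tsum_eq, Complex.ofReal_add,
    Complex.ofReal_mul 2, h_re, Complex.ofReal_ofNat]

theorem hessOp_eq (hA : IsAdapted t γ η) (h k : L1) :
    hessOp t γ h k = contourInt γ (1 * constI (hop h) *
      (resI γ (hop t) * constI (hop k) * resI γ (hop t))) := by
  refine cauchyInt_eq_contourInt γ _ _ fun s => ?_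
  rw [one_mul, ← mul_assoc, ← mul_assoc]
  simp only [ContinuousMap.mul_apply, constI_apply, resI_apply hA.avoids_zero]

theorem isTraceClass_hessOp (hA : IsAdapted t γ η) (h k : L1) :
    IsTraceClass (hessOp t γ h k) := by
  rw [hA.hessOp_eq]
  exact isTraceClass_contourInt _ _ _ _

theorem trace_hessOp (hA : IsAdapted t γ η) (h k : L1) :
    trace (hessOp t γ h k) = slopeDeriv t γ 0 h k := by
  rw [hA.hessOp_eq, trace_contourInt, mul_one, slopeDeriv_zero_apply]

theorem ofReal_energyHess (hA : IsAdapted t γ η) (h k : L1) :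
    (energyHess μ t γ h k : ℂ)
      = ((μ * ∑' n : ℤ, h n * k n : ℝ) : ℂ) + 2 * trace (hessOp t γ h k) := by
  have h_re : ((slopeDeriv t γ 0 h k).re : ℂ) = slopeDeriv t γ 0 h k :=
    Complex.conj_eq_iff_re.1 (Complex.conj_eq_iff_im.2 (hA.slopeDeriv_zero_im h k))
  rw [energyHess_apply, (hasSum_dotForm h k).tsum_eq, hA.trace_hessOp, Complex.ofReal_add,
    Complex.ofReal_mul 2, h_re, Complex.ofReal_ofNat]

end IsAdapted

theorem norm_energyHess_le (h k : L1) :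
    ‖energyHess μ t γ h k‖ ≤
      (|μ| + 8 * γ.len * ‖resI γ (hop t)‖ ^ 2) * ‖toL2 h‖ * ‖toL2 k‖ := by
  have h_trace : ‖(slopeDeriv t γ 0 h k).re‖
      ≤ γ.len * (4 * ‖resI γ (hop t)‖ * ‖resI γ (hop t)‖ * ‖toL2 h‖ * ‖toL2 k‖) := by
    rw [slopeDeriv_zero_apply]
    exact (Complex.abs_re_le_norm _).trans (norm_hopTrace_contourInt_le γ k _ _ h)
  calc ‖energyHess μ t γ h k‖
      ≤ ‖μ * dotForm h k‖ + ‖2 * (slopeDeriv t γ 0 h k).re‖ := norm_add_le _ _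
    _ = |μ| * ‖dotForm h k‖ + 2 * ‖(slopeDeriv t γ 0 h k).re‖ := by
        rw [norm_mul, norm_mul, Real.norm_eq_abs μ, Real.norm_of_nonneg zero_le_two]
    _ ≤ |μ| * (‖toL2 h‖ * ‖toL2 k‖) + 2 * (γ.len * (4 * ‖resI γ (hop t)‖ * ‖resI γ (hop t)‖
          * ‖toL2 h‖ * ‖toL2 k‖)) := by
        gcongr
        exact norm_dotForm_le h k
    _ = _ := by ring

theorem IsAdapted.taylor_remainder_eq (hA : IsAdapted t γ η) {h : L1} (hh : ‖h‖ ≤ η) :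
    energyDiff μ t h - energyDeriv μ γ hb 0 h - 1 / 2 * energyHess μ t γ h h
      = 2 * (hopTrace h (contourInt γ (zetaI _ γ * (resI γ (hop t) * resI γ (hop t))
          * constI (hop h) * (resI γ (hop t) * constI (hop h) * resI γ (hop t + hopL h))))).re := by
  have re_half (z : ℂ) : (1 / 2 * z).re = 1 / 2 * z.re := by
    rw [show (1 / 2 : ℂ) = ((1 / 2 : ℝ) : ℂ) by norm_num, Complex.re_ofReal_mul]
  rw [hA.energyDiff_eq_contourEnergy hb hh, contourEnergy, hA.hopTrace_chordInt hh,
    energyHess_apply, energyDeriv_zero_apply, Complex.add_re, Complex.add_re, re_half]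
  ring

theorem norm_constI_hop_le (h : L1) :
    ‖(constI (hop h) : C(unitInterval, Hil →L[ℂ] Hil))‖ ≤ 2 * ‖toL2 h‖ := by
  have h_bdd (n : ℤ) : |h n| ≤ ‖toL2 h‖ := lp.norm_apply_le_norm two_ne_zero (toL2 h) n
  exact (ContinuousMap.norm_le _ (by positivity)).2 fun _ => norm_hop_le h_bdd

theorem IsAdapted.exists_taylor_remainder_le (hA : IsAdapted t γ η) (hb : ∀ n, ‖t n - 1‖ ≤ M) :
    ∃ C : ℝ, 0 ≤ C ∧ ∀ h : L1, ‖h‖ ≤ η →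
      |energyDiff μ t h - energyDeriv μ γ hb 0 h - 1 / 2 * energyHess μ t γ h h|
        ≤ C * ‖toL2 h‖ ^ 3 := by
  obtain ⟨K, hK_nonneg, hK⟩ := hA.exists_norm_resI_le
  let r := resI γ (hop t)
  let ζ := zetaI (Hil →L[ℂ] Hil) γ
  have h_len := γ.len_nonneg
  refine ⟨2 * (γ.len * (4 * ‖ζ * (r * r)‖ * (‖r‖ * 2 * K))), by positivity, fun h hh => ?_⟩
  have h_factor : ‖r * constI (hop h) * resI γ (hop t + hopL h)‖ ≤ ‖r‖ * (2 * ‖toL2 h‖) * K :=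
    calc ‖r * constI (hop h) * resI γ (hop t + hopL h)‖
        ≤ ‖r‖ * ‖(constI (hop h) : C(unitInterval, Hil →L[ℂ] Hil))‖
          * ‖resI γ (hop t + hopL h)‖ := norm_mul₃_le
      _ ≤ ‖r‖ * (2 * ‖toL2 h‖) * K := by
        gcongr
        · exact norm_constI_hop_le h
        · exact hK h hh
  rw [hA.taylor_remainder_eq hb hh, abs_mul, abs_two]
  calc _ ≤ 2 * (γ.len * (4 * ‖ζ * (r * r)‖ * ‖r * constI (hop h) * resI γ (hop t + hopL h)‖
          * ‖toL2 h‖ * ‖toL2 h‖)) :=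
        mul_le_mul_of_nonneg_left ((Complex.abs_re_le_norm _).trans
          (norm_hopTrace_contourInt_le γ h _ _ h)) zero_le_two
    _ ≤ 2 * (γ.len * (4 * ‖ζ * (r * r)‖ * (‖r‖ * (2 * ‖toL2 h‖) * K)
          * ‖toL2 h‖ * ‖toL2 h‖)) := by gcongr
    _ = _ := by ring

end Energy

section BilinearExtension

variable {E F : Type*} [NormedAddCommGroup E] [NormedSpace ℝ E] [NormedAddCommGroup F]
  [NormedSpace ℝ F]

theorem exists_bilinear_extension {ι : E →L[ℝ] F} (hι : DenseRange ι) (B : E →L[ℝ] E →L[ℝ] ℝ)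
    {C : ℝ} (hC : 0 ≤ C) (hB : ∀ h k, ‖B h k‖ ≤ C * ‖ι h‖ * ‖ι k‖) :
    ∃ B₂ : F →L[ℝ] F →L[ℝ] ℝ, ∀ h k, B₂ (ι h) (ι k) = B h k := by
  have h_dense : DenseRange ι.toLinearMap := hι
  have h_ext (h k : E) : (B h).toLinearMap.extendOfNorm ι.toLinearMap (ι k) = B h k :=
    LinearMap.extendOfNorm_eq (f := (B h).toLinearMap) h_dense ⟨_, hB h⟩ k
  let f : E →ₗ[ℝ] (F →L[ℝ] ℝ) :=
    { toFun := fun h => (B h).toLinearMap.extendOfNorm ι.toLinearMap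
      map_add' := fun h h' => by
        refine ContinuousLinearMap.ext fun x => ?_
        refine hι.induction_on x (isClosed_eq (by fun_prop) (by fun_prop)) fun k => ?_
        rw [add_apply, h_ext, h_ext, h_ext, map_add, add_apply]
      map_smul' := fun c h => by
        refine ContinuousLinearMap.ext fun x => ?_
        refine hι.induction_on x (isClosed_eq (by fun_prop) (by fun_prop)) fun k => ?_
        rw [RingHom.id_apply, smul_apply, h_ext, h_ext, map_smul, smul_apply] }
  have h_bound : ∃ C, ∀ h, ‖f h‖ ≤ C * ‖ι.toLinearMap h‖ :=
    ⟨C, fun h => LinearMap.opNorm_extendOfNorm_le h_dense (by positivity) (hB h)⟩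
  have h_eq (h : E) : f.extendOfNorm ι.toLinearMap (ι h) = f h :=
    LinearMap.extendOfNorm_eq h_dense h_bound h
  exact ⟨f.extendOfNorm ι.toLinearMap, fun h k => by rw [h_eq]; exact h_ext h k⟩

end BilinearExtension

/-! ### Recurrence inequalities -/

section Recurrence

theorem tsum_le_of_le_succ {x y : ℕ → ℝ} {ρ C : ℝ} (hx : 0 ≤ x 0) (hρ0 : 0 ≤ ρ) (hρ : ρ < 1)
    (sx : Summable x) (sy : Summable y) (h : ∀ i, x i ≤ ρ * x (i + 1) + C * y i) :
    ∑' i, x i ≤ C / (1 - ρ) * ∑' i, y i := by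
  have sx' : Summable fun i => x (i + 1) := (summable_nat_add_iff 1).2 sx
  have hsum : ∑' i, x i ≤ ρ * ∑' i, x (i + 1) + C * ∑' i, y i := by
    rw [← tsum_mul_left, ← tsum_mul_left, ← (sx'.mul_left ρ).tsum_add (sy.mul_left C)]
    exact sx.tsum_le_tsum h ((sx'.mul_left ρ).add (sy.mul_left C))
  have hhead : ∑' i, x i = x 0 + ∑' i, x (i + 1) := sx.tsum_eq_zero_add
  rw [div_mul_eq_mul_div, le_div_iff₀ (sub_pos.2 hρ)]
  linarith [mul_nonneg hρ0 hx, congrArg (ρ * ·) hhead]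

theorem tsum_le_of_succ_le {x y : ℕ → ℝ} {ρ C : ℝ} (hρ : ρ < 1) (sx : Summable x)
    (sy : Summable y) (h : ∀ i, x (i + 1) ≤ ρ * x i + C * y i) :
    ∑' i, x i ≤ (x 0 + C * ∑' i, y i) / (1 - ρ) := by
  have sx' : Summable fun i => x (i + 1) := (summable_nat_add_iff 1).2 sx
  have hsum : ∑' i, x (i + 1) ≤ ρ * ∑' i, x i + C * ∑' i, y i := by
    rw [← tsum_mul_left, ← tsum_mul_left, ← (sx.mul_left ρ).tsum_add (sy.mul_left C)]
    exact sx'.tsum_le_tsum h ((sx.mul_left ρ).add (sy.mul_left C))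
  have hhead : ∑' i, x i = x 0 + ∑' i, x (i + 1) := sx.tsum_eq_zero_add
  rw [le_div_iff₀ (sub_pos.2 hρ)]
  linarith

/-- The sum of a sequence on `ℤ` over the half-line `[c, ∞)`. -/
def tailSum (X : ℤ → ℝ) (c : ℤ) : ℝ := ∑' i : ℕ, X (c + i)

variable {X Y : ℤ → ℝ} {ρ R C : ℝ}

theorem summable_tail (sX : Summable X) (c : ℤ) : Summable fun i : ℕ => X (c + i) :=
  sX.comp_injective fun i j h => by simpa using h

theorem tailSum_eq_add (sX : Summable X) (c : ℤ) : tailSum X c = X c + tailSum X (c + 1) := by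
  rw [tailSum, (summable_tail sX c).tsum_eq_zero_add, tailSum]
  simp [add_assoc, add_comm (1 : ℤ)]

theorem le_tailSum (hX : ∀ m, 0 ≤ X m) (sX : Summable X) (c : ℤ) : X c ≤ tailSum X c := by
  rw [tailSum_eq_add sX]
  exact le_add_of_nonneg_right (tsum_nonneg fun _ => hX _)

theorem tailSum_le_tsum (hX : ∀ m, 0 ≤ X m) (sX : Summable X) (c : ℤ) :
    tailSum X c ≤ ∑' m, X m :=
  tsum_comp_le_tsum_of_inj sX hX fun i j h => by simpa using h

theorem tsum_le_tailSum_add_tailSum_neg (hX : ∀ m, 0 ≤ X m) (sX : Summable X) (c : ℤ) :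
    ∑' m, X m ≤ tailSum X c + tailSum (fun m => X (-m)) (-c) := by
  have sX' : Summable fun m => X (-m) := (Equiv.neg ℤ).summable_iff.2 sX
  have hsplit := tsum_of_nat_of_neg_add_one (f := fun m : ℤ => X (c + m)) (summable_tail sX c)
    ((summable_tail sX' (-c + 1)).congr fun i => congrArg X (by ring))
  rw [← (Equiv.addLeft c).tsum_eq X, tailSum_eq_add sX' (-c)]
  refine hsplit.le.trans (add_le_add_right ?_ _)
  refine (tsum_congr fun i : ℕ => congrArg X ?_).le.trans (le_add_of_nonneg_left (hX _))
  ring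

theorem tailSum_sub_add_le (hX : ∀ m, 0 ≤ X m) (hY : ∀ m, 0 ≤ Y m) (sX : Summable X)
    (sY : Summable Y) (hR : 0 ≤ R) (hC : 0 ≤ C) (h : ∀ m, X m ≤ R * X (m + 1) + C * Y m)
    (c : ℤ) (j : ℕ) :
    tailSum X (c - j) + C * ∑' m, Y m ≤ (R + 2) ^ j * (tailSum X c + C * ∑' m, Y m) := by
  induction j with
  | zero => simp
  | succ j ih =>
    have hstep := h (c - (j + 1 : ℕ))
    have htail := tailSum_eq_add sX (c - (j + 1 : ℕ))
    rw [show c - (j + 1 : ℕ) + 1 = c - j by push_cast; ring] at hstep htail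
    have hYle : C * Y (c - (j + 1 : ℕ)) ≤ C * ∑' m, Y m :=
      mul_le_mul_of_nonneg_left (sY.le_tsum _ fun _ _ => hY _) hC
    have hXle := mul_le_mul_of_nonneg_left (le_tailSum hX sX (c - j)) hR
    have hT : 0 ≤ tailSum X (c - j) := tsum_nonneg fun _ => hX _
    have hy : 0 ≤ R * (C * ∑' m, Y m) := mul_nonneg hR (mul_nonneg hC (tsum_nonneg hY))
    calc tailSum X (c - (j + 1 : ℕ)) + C * ∑' m, Y m
        ≤ (R + 2) * (tailSum X (c - j) + C * ∑' m, Y m) := by linarith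
      _ ≤ (R + 2) * ((R + 2) ^ j * (tailSum X c + C * ∑' m, Y m)) := by gcongr
      _ = (R + 2) ^ (j + 1) * (tailSum X c + C * ∑' m, Y m) := by ring

theorem tailSum_neg_le (hX : ∀ m, 0 ≤ X m) (hY : ∀ m, 0 ≤ Y m) (sX : Summable X)
    (sY : Summable Y) (hρ0 : 0 ≤ ρ) (hρ : ρ < 1) (hC : 0 ≤ C) {c : ℤ}
    (h : (∀ m, m < c → X m ≤ ρ * X (m + 1) + C * Y m) ∨
      ∀ m, m < c → X (m + 1) ≤ ρ * X m + C * Y m) :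
    tailSum (fun m => X (-m)) (-c) ≤ (X c + C * ∑' m, Y m) / (1 - ρ) := by
  have sX' := summable_tail ((Equiv.neg ℤ).summable_iff.2 sX) (-c)
  have sY' := (Equiv.neg ℤ).summable_iff.2 sY
  have hYle : tailSum (fun m => Y (-m)) (-c + 1) ≤ ∑' m, Y m :=
    (tailSum_le_tsum (fun _ => hY _) sY' _).trans_eq ((Equiv.neg ℤ).tsum_eq Y)
  have : 0 < 1 - ρ := sub_pos.2 hρ
  have hidx (i : ℕ) : -(-c + i) = -(-c + 1 + i) + 1 := by ring
  have hidx' (i : ℕ) : -(-c + (i + 1 : ℕ)) = -(-c + 1 + i) := by push_cast; ring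
  rcases h with h | h
  · refine (tsum_le_of_succ_le hρ sX' (summable_tail sY' (-c + 1)) (C := C) fun i => ?_).trans ?_
    · simpa only [Function.comp_apply, Equiv.neg_apply, hidx i, hidx' i] using
        h (-(-c + 1 + i)) (by omega)
    · simp only [Function.comp_apply, Equiv.neg_apply, Nat.cast_zero, add_zero, neg_neg]
      gcongr
      exact hYle
  · refine (tsum_le_of_le_succ (hX _) hρ0 hρ sX' (summable_tail sY' (-c + 1)) (C := C)
      fun i => ?_).trans ?_
    · simpa only [Function.comp_apply, Equiv.neg_apply, hidx i, hidx' i] using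
        h (-(-c + 1 + i)) (by omega)
    · rw [div_mul_eq_mul_div]
      gcongr
      exact (mul_le_mul_of_nonneg_left hYle hC).trans (le_add_of_nonneg_left (hX c))

theorem exists_tsum_le_of_recurrence (hρ0 : 0 ≤ ρ) (hρ : ρ < 1) (hR : 0 ≤ R)
    (hC : 0 ≤ C) (N : ℕ) :
    ∃ K, 0 ≤ K ∧ ∀ X Y : ℤ → ℝ, (∀ m, 0 ≤ X m) → (∀ m, 0 ≤ Y m) → Summable X → Summable Y →
      (∀ m, X m ≤ R * X (m + 1) + C * Y m) →
      (∀ m, (N : ℤ) ≤ m → X m ≤ ρ * X (m + 1) + C * Y m) →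
      ((∀ m, m < -(N : ℤ) → X m ≤ ρ * X (m + 1) + C * Y m) ∨
        (∀ m, m < -(N : ℤ) → X (m + 1) ≤ ρ * X m + C * Y m)) →
      ∑' m, X m ≤ K * ∑' m, Y m := by
  have : 0 < 1 - ρ := sub_pos.2 hρ
  set K := (R + 2) ^ (2 * N) * (C / (1 - ρ) + C)
  refine ⟨K + (K + C) / (1 - ρ), by positivity, fun X Y hX hY sX sY hall hright hleft => ?_⟩
  have hfar : tailSum X N ≤ C / (1 - ρ) * ∑' m, Y m := by
    refine (tsum_le_of_le_succ (hX _) hρ0 hρ (summable_tail sX N) (summable_tail sY N)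
      fun i => ?_).trans (mul_le_mul_of_nonneg_left (tailSum_le_tsum hY sY N) (by positivity))
    simpa only [Nat.cast_succ, add_assoc] using hright (N + i) (by omega)
  have hnear : tailSum X (-N) ≤ K * ∑' m, Y m := by
    have hsub := tailSum_sub_add_le hX hY sX sY hR hC hall N (2 * N)
    rw [show (N : ℤ) - (2 * N : ℕ) = -N by push_cast; ring] at hsub
    calc tailSum X (-N) ≤ tailSum X (-N) + C * ∑' m, Y m :=
          le_add_of_nonneg_right (mul_nonneg hC (tsum_nonneg hY))
      _ ≤ (R + 2) ^ (2 * N) * (C / (1 - ρ) * ∑' m, Y m + C * ∑' m, Y m) :=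
          hsub.trans (by gcongr)
      _ = K * ∑' m, Y m := by ring
  calc ∑' m, X m ≤ tailSum X (-N) + tailSum (fun m => X (-m)) (- -N) :=
        tsum_le_tailSum_add_tailSum_neg hX sX _
    _ ≤ K * ∑' m, Y m + (K * ∑' m, Y m + C * ∑' m, Y m) / (1 - ρ) := by
        refine add_le_add hnear ((tailSum_neg_le hX hY sX sY hρ0 hρ hC hleft).trans ?_)
        gcongr
        exact (le_tailSum hX sX _).trans hnear
    _ = (K + (K + C) / (1 - ρ)) * ∑' m, Y m := by ring

end Recurrence

/-! ### The lower bound on the even sublattice -/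

section LowerBound

theorem tPlus_even (W δ : ℝ) (m : ℤ) : tPlus W δ (2 * m) = W + δ := by
  simp [tPlus, zpow_mul]

theorem tPlus_odd (W δ : ℝ) (m : ℤ) : tPlus W δ (2 * m + 1) = W - δ := by
  simp [tPlus, zpow_add₀, zpow_mul, sub_eq_add_neg]

theorem tMinus_even (W δ : ℝ) (m : ℤ) : tMinus W δ (2 * m) = W - δ := by
  simp [tMinus, zpow_mul]

theorem tMinus_odd (W δ : ℝ) (m : ℤ) : tMinus W δ (2 * m + 1) = W + δ := by
  simp [tMinus, zpow_add₀, zpow_mul]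

theorem abs_tPlus_le (W δ : ℝ) (n : ℤ) : |tPlus W δ n| ≤ |W| + |δ| :=
  (abs_add_le _ _).trans_eq (by simp [abs_mul, abs_zpow])

theorem abs_tMinus_le (W δ : ℝ) (n : ℤ) : |tMinus W δ n| ≤ |W| + |δ| :=
  (abs_sub _ _).trans_eq (by simp [abs_mul, abs_zpow])

variable {W δ : ℝ} {t : ℤ → ℝ}

theorem exists_bound (ht : IsHomoclinic W δ t ∨ IsHeteroclinic W δ t) :
    ∃ M : ℝ, ∀ n, |t n| ≤ M := by
  have key {l : Filter ℤ} {s : ℤ → ℝ} (hs : ∀ n, |s n| ≤ |W| + |δ|)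
      (h : Filter.Tendsto (fun n => |t n - s n|) l (nhds 0)) :
      ∀ᶠ n in l, |t n| ≤ |W| + |δ| + 1 := by
    filter_upwards [h.eventually_lt_const zero_lt_one] with n hn
    linarith [abs_sub_abs_le_abs_sub (t n) (s n), hs n]
  have hr := key (abs_tPlus_le W δ) (ht.elim (fun h => h.2) fun h => h.2)
  have hl := ht.elim (fun h => key (abs_tPlus_le W δ) h.1) fun h => key (abs_tMinus_le W δ) h.1
  obtain ⟨b, hb⟩ := Filter.eventually_atTop.1 hr
  obtain ⟨a, ha⟩ := Filter.eventually_atBot.1 hl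
  obtain ⟨K, hK⟩ := ((Set.finite_Icc a b).image fun n => |t n|).bddAbove
  refine ⟨max (|W| + |δ| + 1) K, fun n => ?_⟩
  rcases le_total n a with h | h
  · exact le_max_of_le_left (ha n h)
  rcases le_total b n with h' | h'
  · exact le_max_of_le_left (hb n h')
  · exact le_max_of_le_right (hK ⟨n, ⟨h, h'⟩, rfl⟩)

theorem eventually_le_ratio_mul (hW : 0 < W) (hδ : 0 < δ) {l : Filter ℤ} {s : ℤ → ℝ}
    (h : Filter.Tendsto (fun n => |t n - s n|) l (nhds 0)) {i j : ℤ → ℤ}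
    (hi : Filter.Tendsto i l l) (hj : Filter.Tendsto j l l) (hsi : ∀ m, s (i m) = W + δ)
    (hsj : ∀ m, s (j m) = W - δ) : ∀ᶠ m in l, t (j m) ≤ W / (W + δ) * t (i m) := by
  have hlim {φ : ℤ → ℤ} {a : ℝ} (hφ : Filter.Tendsto φ l l) (hs : ∀ m, s (φ m) = a) :
      Filter.Tendsto (fun m => t (φ m)) l (nhds a) :=
    tendsto_sub_nhds_zero_iff.1 <| (tendsto_zero_iff_abs_tendsto_zero _).2 <| by
      simpa only [Function.comp_def, hs] using h.comp hφ
  have hWδ : W / (W + δ) * (W + δ) = W := div_mul_cancel₀ _ (by positivity)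
  exact ((hlim hj hsj).eventually_lt ((hlim hi hsi).const_mul _) (by linarith)).mono
    fun _ => le_of_lt

theorem exists_ratio (hW : 0 < W) (hδ : 0 < δ) (ht : IsHomoclinic W δ t ∨ IsHeteroclinic W δ t) :
    ∃ ρ : ℝ, 0 ≤ ρ ∧ ρ < 1 ∧ ∃ N : ℕ,
      (∀ m, (N : ℤ) ≤ m → t (2 * m + 1) ≤ ρ * t (2 * m)) ∧
      ((∀ m, m < -(N : ℤ) → t (2 * m + 1) ≤ ρ * t (2 * m)) ∨
        (∀ m, m < -(N : ℤ) → t (2 * m) ≤ ρ * t (2 * m + 1))) := by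
  have htop : Filter.Tendsto (fun m : ℤ => 2 * m) Filter.atTop Filter.atTop :=
    Filter.tendsto_id.const_mul_atTop' (by norm_num : (0 : ℤ) < 2)
  have hbot : Filter.Tendsto (fun m : ℤ => 2 * m) Filter.atBot Filter.atBot :=
    Filter.tendsto_atBot.2 fun b => (Filter.eventually_le_atBot (min b 0)).mono fun _ _ => by omega
  have htop' : Filter.Tendsto (fun m : ℤ => 2 * m + 1) Filter.atTop Filter.atTop :=
    Filter.tendsto_atTop_add_const_right _ _ htop
  have hbot' : Filter.Tendsto (fun m : ℤ => 2 * m + 1) Filter.atBot Filter.atBot :=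
    Filter.tendsto_atBot_add_const_right _ _ hbot
  obtain ⟨b, hb⟩ := Filter.eventually_atTop.1 <| eventually_le_ratio_mul hW hδ
    (ht.elim (fun h => h.2) fun h => h.2) htop htop' (tPlus_even W δ) (tPlus_odd W δ)
  refine ⟨W / (W + δ), by positivity, (div_lt_one (by positivity)).2 (by linarith), ?_⟩
  rcases ht with h | h
  · obtain ⟨a, ha⟩ := Filter.eventually_atBot.1 <|
      eventually_le_ratio_mul hW hδ h.1 hbot hbot' (tPlus_even W δ) (tPlus_odd W δ)
    exact ⟨b.toNat + (-a).toNat, fun m hm => hb m (by omega), Or.inl fun m hm => ha m (by omega)⟩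
  · obtain ⟨a, ha⟩ := Filter.eventually_atBot.1 <|
      eventually_le_ratio_mul hW hδ h.1 hbot' hbot (tMinus_odd W δ) (tMinus_even W δ)
    exact ⟨b.toNat + (-a).toNat, fun m hm => hb m (by omega), Or.inr fun m hm => ha m (by omega)⟩

theorem hasSum_norm_even_sq {f : Hil} (hf : ∀ m : ℤ, f (2 * m + 1) = 0) :
    HasSum (fun m : ℤ => ‖f (2 * m)‖ ^ 2) (‖f‖ ^ 2) := by
  have hi : Function.Injective fun m : ℤ => 2 * m := fun a b h => by simpa using h
  refine (hi.hasSum_iff (f := fun n => ‖f n‖ ^ 2) fun n hn => ?_).2 (hasSum_norm_apply_sq f)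
  rcases Int.even_or_odd' n with ⟨k, rfl | rfl⟩
  · exact absurd ⟨k, rfl⟩ hn
  · simp [hf]

theorem norm_le_of_mul_add_mul_eq {τ a b r : ℝ} (hτ : 0 < τ) (ha : τ ≤ a) (hb : 0 ≤ b)
    (hba : b ≤ r * a) {w z g : ℂ} (h : b * w + a * z = g) : ‖z‖ ≤ r * ‖w‖ + ‖g‖ / τ := by
  have ha0 : 0 < a := hτ.trans_le ha
  have haz : a * ‖z‖ ≤ ‖g‖ + b * ‖w‖ := by
    have hz : (a : ℂ) * z = g - b * w := by rw [← h]; ring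
    have hle := norm_sub_le g (b * w)
    rwa [← hz, norm_mul, norm_mul, Complex.norm_of_nonneg ha0.le, Complex.norm_of_nonneg hb]
      at hle
  have hga : ‖g‖ ≤ a * (‖g‖ / τ) := by
    rw [mul_div_assoc', le_div_iff₀ hτ, mul_comm]
    gcongr
  refine le_of_mul_le_mul_left ?_ ha0
  nlinarith [mul_le_mul_of_nonneg_right hba (norm_nonneg w)]

theorem norm_sq_le_of_mul_add_mul_eq {τ a b r : ℝ} (hτ : 0 < τ) (ha : τ ≤ a) (hb : 0 ≤ b)
    (hba : b ≤ r * a) {w z g : ℂ} (h : b * w + a * z = g) :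
    ‖z‖ ^ 2 ≤ 2 * r ^ 2 * ‖w‖ ^ 2 + 2 / τ ^ 2 * ‖g‖ ^ 2 :=
  (pow_le_pow_left₀ (norm_nonneg _) (norm_le_of_mul_add_mul_eq hτ ha hb hba h) 2).trans <|
    add_sq_le.trans_eq (by ring)

theorem norm_sq_le_of_mul_add_mul_eq_of_lt_one {τ a b ρ : ℝ} (hτ : 0 < τ) (ha : τ ≤ a)
    (hb : 0 ≤ b) (hρ0 : 0 ≤ ρ) (hρ : ρ < 1) (hba : b ≤ ρ * a) {w z g : ℂ}
    (h : b * w + a * z = g) :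
    ‖z‖ ^ 2 ≤ ρ * ‖w‖ ^ 2 + 1 / (1 - ρ) / τ ^ 2 * ‖g‖ ^ 2 := by
  have hlin := norm_le_of_mul_add_mul_eq hτ ha hb hba h
  have hρ' : 0 < 1 - ρ := sub_pos.2 hρ
  have hdefect : ρ * ‖w‖ ^ 2 + 1 / (1 - ρ) / τ ^ 2 * ‖g‖ ^ 2 - (ρ * ‖w‖ + ‖g‖ / τ) ^ 2
      = ρ / (1 - ρ) * ((1 - ρ) * ‖w‖ - ‖g‖ / τ) ^ 2 := by
    field_simp
    ring
  have : 0 ≤ ρ / (1 - ρ) * ((1 - ρ) * ‖w‖ - ‖g‖ / τ) ^ 2 := by positivity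
  linarith [pow_le_pow_left₀ (norm_nonneg z) hlin 2]

variable {M τ ρ : ℝ}

/-- On even `f`, the equation `T f = g` is a two-term recurrence between neighbouring even sites,
contracting near `±∞`. -/
theorem exists_le_norm_hop_of_ratio (hM : ∀ n, |t n| ≤ M) (hτ : 0 < τ) (htτ : ∀ n, τ ≤ t n)
    (hρ0 : 0 ≤ ρ) (hρ : ρ < 1) {N : ℕ}
    (hright : ∀ m, (N : ℤ) ≤ m → t (2 * m + 1) ≤ ρ * t (2 * m))
    (hleft : (∀ m, m < -(N : ℤ) → t (2 * m + 1) ≤ ρ * t (2 * m)) ∨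
      (∀ m, m < -(N : ℤ) → t (2 * m) ≤ ρ * t (2 * m + 1))) :
    ∃ c : ℝ, 0 < c ∧ ∀ f : Hil, (∀ m : ℤ, f (2 * m + 1) = 0) → c * ‖f‖ ≤ ‖hop t f‖ := by
  have : 0 < 1 - ρ := sub_pos.2 hρ
  have ht0 (n : ℤ) : 0 ≤ t n := hτ.le.trans (htτ n)
  obtain ⟨C, hC, hC'⟩ : ∃ C, 2 / τ ^ 2 ≤ C ∧ 1 / (1 - ρ) / τ ^ 2 ≤ C :=
    ⟨_, le_max_left _ _, le_max_right _ _⟩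
  obtain ⟨K, hK, hrec⟩ := exists_tsum_le_of_recurrence (R := 2 * (M / τ) ^ 2) (C := C) hρ0 hρ
    (by positivity) ((by positivity : 0 ≤ 2 / τ ^ 2).trans hC) N
  refine ⟨(Real.sqrt (K + 1))⁻¹, by positivity, fun f hf => ?_⟩
  have heq (m : ℤ) : t (2 * m + 1) * f (2 * (m + 1)) + t (2 * m) * f (2 * m)
      = hop t f (2 * m + 1) := by
    rw [hop_apply ⟨M, hM⟩, add_sub_cancel_right, show 2 * m + 1 + 1 = 2 * (m + 1) by ring]
  have hratio (m : ℤ) : t (2 * m + 1) ≤ M / τ * t (2 * m) := by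
    rw [div_mul_eq_mul_div, le_div_iff₀ hτ]
    exact mul_le_mul ((le_abs_self _).trans (hM _)) (htτ _) hτ.le ((abs_nonneg _).trans (hM 0))
  have hall (m : ℤ) := (norm_sq_le_of_mul_add_mul_eq hτ (htτ _) (ht0 _) (hratio m)
    (heq m)).trans (add_le_add_right (mul_le_mul_of_nonneg_right hC (sq_nonneg _)) _)
  have hforward {m : ℤ} (h : t (2 * m + 1) ≤ ρ * t (2 * m)) :=
    (norm_sq_le_of_mul_add_mul_eq_of_lt_one hτ (htτ _) (ht0 _) hρ0 hρ h (heq m)).trans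
      (add_le_add_right (mul_le_mul_of_nonneg_right hC' (sq_nonneg _)) _)
  have hbackward {m : ℤ} (h : t (2 * m) ≤ ρ * t (2 * m + 1)) :=
    (norm_sq_le_of_mul_add_mul_eq_of_lt_one hτ (htτ _) (ht0 _) hρ0 hρ h
      ((add_comm _ _).trans (heq m))).trans
        (add_le_add_right (mul_le_mul_of_nonneg_right hC' (sq_nonneg _)) _)
  have sX := hasSum_norm_even_sq hf
  have sT := hasSum_norm_apply_sq (hop t f)
  have hodd : Function.Injective fun m : ℤ => 2 * m + 1 := fun a b h => by simpa using h
  have hsum := hrec (fun m => ‖f (2 * m)‖ ^ 2) (fun m => ‖hop t f (2 * m + 1)‖ ^ 2)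
    (fun _ => sq_nonneg _) (fun _ => sq_nonneg _) sX.summable (sT.summable.comp_injective hodd)
    hall (fun m hm => hforward (hright m hm))
    (hleft.imp (fun h m hm => hforward (h m hm)) fun h m hm => hbackward (h m hm))
  have hT : ∑' m : ℤ, ‖hop t f (2 * m + 1)‖ ^ 2 ≤ ‖hop t f‖ ^ 2 :=
    (tsum_comp_le_tsum_of_inj sT.summable (fun _ => sq_nonneg _) hodd).trans_eq sT.tsum_eq
  rw [inv_mul_le_iff₀ (by positivity)]
  refine le_of_sq_le_sq ?_ (by positivity)
  rw [mul_pow, Real.sq_sqrt (by positivity), ← sX.tsum_eq]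
  nlinarith [sq_nonneg ‖hop t f‖]

end LowerBound

/-! ### The spectral gap -/

section Gap

variable {E : Type*} [NormedAddCommGroup E] [InnerProductSpace ℂ E] [CompleteSpace E]
  {D P : E →L[ℂ] E} {c x : ℝ}

theorem isUnit_of_isSelfAdjoint_of_norm_le {S : E →L[ℂ] E} (hS : IsSelfAdjoint S) {K : NNReal}
    (h : ∀ ψ, ‖ψ‖ ≤ K * ‖S ψ‖) : IsUnit S := by
  have hanti : AntilipschitzWith K S := S.antilipschitz_of_bound h
  rw [ContinuousLinearMap.isUnit_iff_bijective,
    ContinuousLinearMap.bijective_iff_dense_range_and_antilipschitz,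
    Submodule.topologicalClosure_eq_top_iff, ContinuousLinearMap.orthogonal_range,
    hS.adjoint_eq]
  exact ⟨LinearMap.ker_eq_bot.2 hanti.injective, K, hanti⟩

theorem sq_sub_sq_mul_norm_le (hD : IsSelfAdjoint D) (hc : 0 ≤ c) {f : E}
    (hf : c * ‖f‖ ≤ ‖D f‖) : (c ^ 2 - x ^ 2) * ‖f‖ ≤ ‖((x : ℂ) ^ 2) • f - D (D f)‖ := by
  rcases (norm_nonneg f).eq_or_lt with h0 | h0
  · rw [← h0, mul_zero]
    exact norm_nonneg _
  have hDD : inner ℂ (D (D f)) f = ((‖D f‖ ^ 2 : ℝ) : ℂ) := by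
    rw [← ContinuousLinearMap.adjoint_inner_right, hD.adjoint_eq, inner_self_eq_norm_sq_to_K]
    norm_cast
  have hinner : inner ℂ (((x : ℂ) ^ 2) • f - D (D f)) f
      = ((x ^ 2 * ‖f‖ ^ 2 - ‖D f‖ ^ 2 : ℝ) : ℂ) := by
    rw [inner_sub_left, inner_smul_left, hDD, inner_self_eq_norm_sq_to_K]
    simp
  have hcs := norm_inner_le_norm (𝕜 := ℂ) (((x : ℂ) ^ 2) • f - D (D f)) f
  rw [hinner, Complex.norm_real, Real.norm_eq_abs] at hcs
  refine le_of_mul_le_mul_right (le_trans ?_ hcs) h0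
  calc (c ^ 2 - x ^ 2) * ‖f‖ * ‖f‖ = (c * ‖f‖) ^ 2 - x ^ 2 * ‖f‖ ^ 2 := by ring
    _ ≤ ‖D f‖ ^ 2 - x ^ 2 * ‖f‖ ^ 2 := by gcongr
    _ ≤ |x ^ 2 * ‖f‖ ^ 2 - ‖D f‖ ^ 2| := by
      rw [abs_sub_comm]
      exact le_abs_self _

/-- Since `(x P + D (1 - P)) (x - D) = (x ^ 2 - D ^ 2) P`, the lower bound on the range of `P`
controls `P ψ` by `(x - D) ψ`; the other component is then recovered because `x ≠ 0`. -/
theorem notMem_spectrum_of_gap (hD : IsSelfAdjoint D) (hPP : P * P = P)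
    (hDP : D * P + P * D = D) (hc : ∀ f, P f = f → c * ‖f‖ ≤ ‖D f‖) (hx0 : x ≠ 0)
    (hx : |x| < c) : (x : ℂ) ∉ spectrum ℂ D := by
  have hc0 : 0 < c := (abs_nonneg x).trans_lt hx
  have hcx : 0 < c ^ 2 - x ^ 2 := sub_pos.2 (sq_lt_sq.2 (by rwa [abs_of_pos hc0]))
  set S : E →L[ℂ] E := algebraMap ℂ (E →L[ℂ] E) x - D
  have hS : IsSelfAdjoint S :=
    (IsSelfAdjoint.algebraMap (E →L[ℂ] E) (Complex.conj_ofReal x)).sub hD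
  set A := (x : ℂ) • P + D * (1 - P)
  have hPD : P * D = D - D * P := eq_sub_of_add_eq' hDP
  have hAS : A * S = ((x : ℂ) ^ 2) • P - D * (D * P) := by
    simp only [A, S, Algebra.algebraMap_eq_smul_one, add_mul, mul_sub, sub_mul, mul_one,
      smul_mul_assoc, mul_smul_comm, mul_assoc, hPD, smul_add, smul_sub, smul_smul, sq]
    abel
  have hQS : (x : ℂ) • (1 - P) = (1 - P) * S + D * P := by
    simp only [S, Algebra.algebraMap_eq_smul_one, mul_sub, sub_mul, one_mul, mul_one,
      mul_smul_comm, hPD, smul_sub]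
    abel
  have hPle (ψ : E) : ‖P ψ‖ ≤ ‖A‖ / (c ^ 2 - x ^ 2) * ‖S ψ‖ := by
    rw [div_mul_eq_mul_div, le_div_iff₀ hcx, mul_comm]
    refine (sq_sub_sq_mul_norm_le hD hc0.le (hc (P ψ) (congrArg (· ψ) hPP))).trans ?_
    exact (congrArg (fun B => ‖B ψ‖) hAS).ge.trans (A.le_opNorm (S ψ))
  set B := ‖A‖ / (c ^ 2 - x ^ 2)
  have hQle (ψ : E) : |x| * ‖ψ - P ψ‖ ≤ (‖1 - P‖ + ‖D‖ * B) * ‖S ψ‖ := by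
    calc |x| * ‖ψ - P ψ‖ = ‖(1 - P) (S ψ) + D (P ψ)‖ := by
          rw [← Real.norm_eq_abs, ← Complex.norm_real, ← norm_smul]
          exact congrArg (fun B => ‖B ψ‖) hQS
      _ ≤ ‖1 - P‖ * ‖S ψ‖ + ‖D‖ * ‖P ψ‖ :=
          norm_add_le_of_le ((1 - P).le_opNorm _) (D.le_opNorm _)
      _ ≤ ‖1 - P‖ * ‖S ψ‖ + ‖D‖ * (B * ‖S ψ‖) := by gcongr; exact hPle ψ
      _ = (‖1 - P‖ + ‖D‖ * B) * ‖S ψ‖ := by ring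
  have : 0 ≤ B := by positivity
  rw [spectrum.mem_iff, not_not]
  refine isUnit_of_isSelfAdjoint_of_norm_le hS
    (K := ⟨B + (‖1 - P‖ + ‖D‖ * B) / |x|, by positivity⟩) fun ψ => ?_
  calc ‖ψ‖ ≤ ‖P ψ‖ + ‖ψ - P ψ‖ := norm_le_insert' ψ (P ψ)
    _ ≤ B * ‖S ψ‖ + (‖1 - P‖ + ‖D‖ * B) / |x| * ‖S ψ‖ := by
      refine add_le_add (hPle ψ) ?_
      rw [div_mul_eq_mul_div, le_div_iff₀ (abs_pos.2 hx0), mul_comm]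
      exact hQle ψ
    _ = (B + (‖1 - P‖ + ‖D‖ * B) / |x|) * ‖S ψ‖ := by ring

end Gap

/-- The projection onto the even sublattice. -/
def evenProj : Hil →L[ℂ] Hil :=
  mulShift (fun n => if Even n then 1 else 0) 1 (fun n => by split_ifs <;> simp) 0

theorem evenProj_apply (ψ : Hil) (n : ℤ) : evenProj ψ n = if Even n then ψ n else 0 := by
  rw [evenProj, mulShift_apply, add_zero]
  split_ifs <;> simp

theorem evenProj_mul_self : evenProj * evenProj = evenProj := by
  ext ψ n
  change evenProj (evenProj ψ) n = evenProj ψ n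
  simp only [evenProj_apply]
  split_ifs <;> rfl

theorem hop_mul_evenProj_add {a : ℤ → ℝ} (ha : ∃ M : ℝ, ∀ n, |a n| ≤ M) :
    hop a * evenProj + evenProj * hop a = hop a := by
  ext ψ n
  change hop a (evenProj ψ) n + evenProj (hop a ψ) n = hop a ψ n
  simp only [evenProj_apply, hop_apply ha, Int.even_add_one, Int.even_sub_one]
  by_cases h : Even n <;> simp [h]

/-- Zero may belong to the spectrum: in the heteroclinic case it is an eigenvalue, carried by the
odd sublattice. -/
theorem notMem_spectrum_hop {a : ℤ → ℝ} (ha : ∃ M : ℝ, ∀ n, |a n| ≤ M) {c x : ℝ}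
    (hc : ∀ f : Hil, (∀ m : ℤ, f (2 * m + 1) = 0) → c * ‖f‖ ≤ ‖hop a f‖) (hx0 : x ≠ 0)
    (hx : |x| < c) : (x : ℂ) ∉ spectrum ℂ (hop a) :=
  notMem_spectrum_of_gap (isSelfAdjoint_hop ha) evenProj_mul_self (hop_mul_evenProj_add ha)
    (fun f hf => hc f fun m => by rw [← hf, evenProj_apply, if_neg (by simp)]) hx0 hx

theorem exists_spectral_gap {W δ τ : ℝ} (hW : 0 < W) (hδ : 0 < δ) (hτ : 0 < τ) {t : ℤ → ℝ}
    (ht : IsHomoclinic W δ t ∨ IsHeteroclinic W δ t) (htτ : ∀ n, τ ≤ t n) :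
    ∃ g η : ℝ, 0 < g ∧ 0 < η ∧ ∀ h : ℤ → ℝ, (∀ n, |h n| ≤ η) → ∀ x : ℝ, x ≠ 0 → |x| < g →
      (x : ℂ) ∉ spectrum ℂ (hop t + hop h) := by
  obtain ⟨M, hM⟩ := exists_bound ht
  obtain ⟨ρ, hρ0, hρ, N, hright, hleft⟩ := exists_ratio hW hδ ht
  obtain ⟨c, hc, hlow⟩ := exists_le_norm_hop_of_ratio hM hτ htτ hρ0 hρ hright hleft
  refine ⟨c / 2, c / 4, by positivity, by positivity, fun h hh x hx0 hx => ?_⟩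
  have hth : ∃ M : ℝ, ∀ n, |(t + h) n| ≤ M :=
    ⟨M + c / 4, fun n => (abs_add_le _ _).trans (add_le_add (hM n) (hh n))⟩
  rw [← hop_add ⟨M, hM⟩ ⟨_, hh⟩]
  refine notMem_spectrum_hop hth (fun f hf => ?_) hx0 hx
  have hH : ‖hop h f‖ ≤ 2 * (c / 4) * ‖f‖ := (hop h).le_of_opNorm_le (norm_hop_le hh) f
  rw [hop_add ⟨M, hM⟩ ⟨_, hh⟩]
  change c / 2 * ‖f‖ ≤ ‖hop t f + hop h f‖
  linarith [hlow f hf, norm_le_add_norm_add (hop t f) (hop h f)]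

/-! ### Riesz projectors -/

section RieszProjector

variable {A : Type*} [NormedRing A] [NormedAlgebra ℂ A] [CompleteSpace A] {γ : Contour} {a : A}

theorem contourInt_one : contourInt γ (1 : C(unitInterval, A)) = 0 :=
  contourInt_eq_zero_of_hasDerivAt γ (algebraMap ℂ A) (fun _ => 1)
    (fun z _ => by simpa using! (Algebra.linearMap ℂ A).toContinuousLinearMap.hasDerivAt (x := z))
    1 fun _ => rfl

theorem contourInt_zetaI_mul_resI (h : γ.Avoids a) :
    contourInt γ (zetaI A γ * resI γ a) = a * contourInt γ (resI γ a) := by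
  rw [mul_contourInt, ← sub_eq_zero, ← map_sub, ← sub_mul, mul_resI h, contourInt_one]

theorem commute_contourInt_resI (h : γ.Avoids a) : Commute a (contourInt γ (resI γ a)) := by
  have h_comm : constI a * resI γ a = resI γ a * constI a := by
    have h_inv := (mul_resI h).trans (resI_mul h).symm
    rw [sub_mul, mul_sub, (zetaI_commute γ (resI γ a)).eq] at h_inv
    exact sub_right_injective h_inv
  rw [Commute, SemiconjBy, mul_contourInt, h_comm]
  exact (map_contourInt γ ((ContinuousLinearMap.mul ℂ A).flip a) (resI γ a)).symm

theorem contourInt_resI_apply_of_apply_eq_zero {E : Type*} [NormedAddCommGroup E]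
    [NormedSpace ℂ E] [CompleteSpace E] {D : E →L[ℂ] E} (h : γ.Avoids D) {ψ : E}
    (hψ : D ψ = 0) :
    contourInt γ (resI γ D) ψ = cauchyInt γ.toFun (fun z => z⁻¹) • ψ := by
  rcases eq_or_ne ψ 0 with rfl | hψ0
  · rw [map_zero, smul_zero]
  have h_res (s : unitInterval) : γ.path s • resI γ D s ψ = ψ := by
    have h_inv : resI γ D s * (algebraMap ℂ _ (γ.path s) - D) = 1 := congrArg (· s) (resI_mul h)
    have := congrArg (· ψ) h_inv
    simpa [Algebra.algebraMap_eq_smul_one, hψ] using this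
  have h_ne (s : unitInterval) : γ.path s ≠ 0 := fun h0 => hψ0 (by
    rw [← h_res s, h0, zero_smul])
  let inv : C(unitInterval, ℂ) := ⟨fun s => (γ.path s)⁻¹, γ.path.continuous.inv₀ h_ne⟩
  rw [cauchyInt_eq_contourInt γ _ inv fun _ => rfl]
  refine (map_contourInt γ (ContinuousLinearMap.apply ℂ E ψ) (resI γ D)).trans
    (Eq.trans ?_ (map_contourInt γ (ContinuousLinearMap.toSpanSingleton ℂ ψ) inv).symm)
  congr 1
  ext s
  exact (eq_inv_smul_iff₀ (h_ne s)).2 (h_res s)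

end RieszProjector

/-! ### The spectral projector -/

section SpectralProjector

variable {E : Type*} [NormedAddCommGroup E] [InnerProductSpace ℂ E] [CompleteSpace E]
  {D P X : E →L[ℂ] E}

theorem negPart_apply_mem_orthogonal_ker (D : E →L[ℂ] E) (ψ : E) :
    negPart D ψ ∈ (LinearMap.ker (negPart D).toLinearMap)ᗮ := by
  intro φ hφ
  have h_adj : (negPart D).adjoint = negPart D := (CFC.negPart_nonneg D).isSelfAdjoint.adjoint_eq
  have h_ker : negPart D φ = 0 := hφ
  rw [← h_adj, ContinuousLinearMap.adjoint_inner_right, h_ker, inner_zero_left]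

theorem negProj_apply_eq_zero {ψ : E} (hψ : negPart D ψ = 0) : negProj D ψ = 0 :=
  (Submodule.starProjection_apply_eq_zero_iff _).2
    (Submodule.le_orthogonal_orthogonal _ (LinearMap.mem_ker.2 hψ))

theorem negProj_mul (hD : IsSelfAdjoint D) : negProj D * D = -negPart D := by
  have h_pos : negProj D * D⁺ = 0 := by
    ext ψ
    exact negProj_apply_eq_zero (congrArg (· ψ) (CFC.negPart_mul_posPart D))
  have h_neg : negProj D * negPart D = negPart D := by
    ext ψ
    exact Submodule.starProjection_eq_self_iff.2 (negPart_apply_mem_orthogonal_ker D ψ)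
  calc negProj D * D = negProj D * (D⁺ - negPart D) :=
        congrArg _ (CFC.posPart_sub_negPart D hD).symm
    _ = -negPart D := by rw [mul_sub, h_pos, h_neg, zero_sub]

theorem eq_zero_of_mul_eq_zero_of_ker (hXD : X * D = 0) (hD : IsSelfAdjoint D)
    (hX : ∀ ψ, D ψ = 0 → X ψ = 0) : X = 0 := by
  have h_star : D * star X = 0 := by rw [← hD.star_eq, ← star_mul, hXD, star_zero]
  refine CStarRing.mul_star_self_eq_zero_iff X |>.1 ?_
  ext ψ
  exact hX _ (congrArg (· ψ) h_star)

theorem commute_of_mul_eq_zero_of_ker {c : ℂ} (hD : IsSelfAdjoint D) (hDP : D * P + P * D = D)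
    (hXD : X * D = 0) (hX : ∀ ψ, D ψ = 0 → X ψ = c • ψ) : Commute P X := by
  have hPD : P * D = D - D * P := eq_sub_of_add_eq' hDP
  refine sub_eq_zero.1 (eq_zero_of_mul_eq_zero_of_ker (D := D) ?_ hD fun ψ hψ => ?_)
  · rw [sub_mul, mul_assoc, hXD, mul_assoc, hPD, mul_sub, ← mul_assoc, hXD]
    simp
  · have h_ker : D (P ψ) = 0 := by
      have := congrArg (· ψ) hDP
      simpa [hψ] using this
    change P (X ψ) - X (P ψ) = 0
    rw [hX ψ hψ, hX _ h_ker, map_smul, sub_self]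

end SpectralProjector

/-- The reflection `J = 2 p - 1`, with `p` the projection on the even sublattice, anticommutes with
the hopping operators and commutes with `X`, so that `Tr (H X) = Tr (J H J X) = - Tr (H X)`. -/
theorem hopTrace_eq_zero_of_commute {X : Hil →L[ℂ] Hil} (hX : Commute evenProj X) (k : L1) :
    hopTrace k X = 0 := by
  set J : Hil →L[ℂ] Hil := evenProj + evenProj - 1
  have hJJ : J * J = 1 := by
    have := evenProj_mul_self
    simp only [J, sub_mul, mul_sub, one_mul, mul_one, add_mul, mul_add, this]
    abel
  have hJX : X * J = J * X := ((hX.add_left hX).sub_left (Commute.one_left X)).symm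
  have hJH : J * hop k = -(hop k * J) := by
    have h_odd := eq_sub_of_add_eq' (hop_mul_evenProj_add k.exists_abs_apply_le)
    simp only [J, sub_mul, mul_sub, one_mul, mul_one, add_mul, mul_add, h_odd]
    abel
  have h_neg : hopTrace k X = -hopTrace k X := by
    calc hopTrace k X = hopTrace k (J * X * J) := by rw [mul_assoc, hJX, ← mul_assoc, hJJ, one_mul]
      _ = trace (J * hop k * (J * X)) := (trace_mul_hop_mul _ _ _).symm
      _ = hopTrace k (-X) := by
        rw [hJH, neg_mul, mul_assoc, ← mul_assoc J, hJJ, one_mul, ← mul_neg, hopTrace_apply]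
      _ = -hopTrace k X := map_neg _ _
  exact self_eq_neg.1 h_neg

/-- The Riesz projector of the contour may differ from the spectral projector on the kernel of
`T`, but this does not affect its trace against a hopping operator. -/
theorem IsAdapted.slope_zero_eq {t : ℤ → ℝ} {γ : Contour} {η : ℝ} (hA : IsAdapted t γ η)
    (ht : ∃ M : ℝ, ∀ n, |t n| ≤ M) (k : L1) :
    slope t γ 0 k = trace (negProj (hop t) * hop k) := by
  have hT := isSelfAdjoint_hop ht
  set T := hop t
  set P := contourInt γ (resI γ T)
  have hPT : P * T = -negPart T := by
    have h_neg := hA.negPart_eq hA.norm_zero_le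
    rw [map_zero, add_zero, contourInt_zetaI_mul_resI hA.avoids_zero] at h_neg
    rw [h_neg, neg_neg, (commute_contourInt_resI hA.avoids_zero).eq]
  have h_comm : Commute evenProj (P - negProj T) := by
    refine commute_of_mul_eq_zero_of_ker hT (hop_mul_evenProj_add ht) ?_
      (c := cauchyInt γ.toFun fun z => z⁻¹) fun ψ hψ => ?_
    · rw [sub_mul, hPT, negProj_mul hT, sub_self]
    · have h_negPart : negPart T ψ = 0 := by
        rw [← neg_eq_zero]
        exact (congrArg (· ψ) hPT).symm.trans ((congrArg P hψ).trans (map_zero P))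
      rw [sub_apply, negProj_apply_eq_zero h_negPart, sub_zero]
      exact contourInt_resI_apply_of_apply_eq_zero hA.avoids_zero hψ
  have h_trace := trace_mul_hop_mul k (negProj T) 1
  rw [mul_one, one_mul] at h_trace
  rw [slope_zero_apply, h_trace, ← sub_eq_zero, ← map_sub]
  exact hopTrace_eq_zero_of_commute h_comm k

/-! ### Circles as contours -/

/-- The circle of center `c` and radius `R`, parametrized by `[0, 1]`. -/
def circleFun (c : ℂ) (R : ℝ) (s : ℝ) : ℂ := circleMap c R (2 * Real.pi * s)

theorem contDiff_circleFun (c : ℂ) (R : ℝ) : ContDiff ℝ 1 (circleFun c R) :=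
  (contDiff_circleMap c R).comp (contDiff_const.mul contDiff_id)

theorem cauchyInt_circleFun {V : Type*} [NormedAddCommGroup V] [NormedSpace ℂ V] (c : ℂ) (R : ℝ)
    (f : ℂ → V) :
    cauchyInt (circleFun c R) f = (2 * (Real.pi : ℂ) * Complex.I)⁻¹ • ∮ z in C(c, R), f z := by
  have h_subst := intervalIntegral.smul_integral_comp_mul_left (a := 0) (b := 1)
    (fun θ => deriv (circleMap c R) θ • f (circleMap c R θ)) (2 * Real.pi)
  have h_deriv (s : ℝ) : deriv (circleFun c R) s = (2 * Real.pi) •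
      deriv (circleMap c R) (2 * Real.pi * s) := deriv_comp_mul_left _ _ _
  rw [mul_zero, mul_one] at h_subst
  simp only [cauchyInt, curveInt, circleIntegral, ← h_subst, h_deriv, smul_assoc,
    intervalIntegral.integral_smul]
  rfl

theorem cauchyInt_circleFun_of_mem {c w : ℂ} {R : ℝ} (hw : w ∈ Metric.ball c R) :
    cauchyInt (circleFun c R) (fun z => (z - w)⁻¹) = 1 := by
  rw [cauchyInt_circleFun, circleIntegral.integral_sub_inv_of_mem_ball hw, smul_eq_mul,
    inv_mul_cancel₀ Complex.two_pi_I_ne_zero]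

theorem cauchyInt_circleFun_of_notMem {c w : ℂ} {R : ℝ} (hR : 0 ≤ R)
    (hw : w ∉ Metric.closedBall c R) :
    cauchyInt (circleFun c R) (fun z => (z - w)⁻¹) = 0 := by
  have h_diff : DifferentiableOn ℂ (fun z => (z - w)⁻¹) (Metric.closedBall c R) := fun z hz =>
    ((differentiableAt_id.sub_const w).inv
      (sub_ne_zero.2 (ne_of_mem_of_not_mem hz hw))).differentiableWithinAt
  rw [cauchyInt_circleFun, DiffContOnCl.circleIntegral_eq_zero hR
    (h_diff.diffContOnCl_ball subset_rfl), smul_zero]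

theorem image_circleFun {c : ℂ} {R : ℝ} (hR : 0 ≤ R) :
    circleFun c R '' Set.Icc 0 1 = Metric.sphere c R := by
  refine Set.Subset.antisymm (Set.image_subset_iff.2 fun s _ => circleMap_mem_sphere c hR _) ?_
  intro w hw
  rw [← abs_of_nonneg hR, ← image_circleMap_Ioc] at hw
  obtain ⟨θ, hθ, rfl⟩ := hw
  have hpi := Real.two_pi_pos
  exact ⟨θ / (2 * Real.pi), ⟨div_nonneg hθ.1.le hpi.le, (div_le_one hpi).2 hθ.2⟩,
    congrArg _ (mul_div_cancel₀ θ hpi.ne')⟩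

theorem injOn_circleFun {c : ℂ} {R : ℝ} (hR : R ≠ 0) : Set.InjOn (circleFun c R) (Set.Ico 0 1) := by
  intro a ha b hb hab
  have hpi := Real.two_pi_pos
  have h_mem {s : ℝ} (hs : s ∈ Set.Ico (0 : ℝ) 1) :
      2 * Real.pi * s ∈ Set.Ico 0 (2 * Real.pi) :=
    ⟨mul_nonneg hpi.le hs.1, mul_lt_of_lt_one_right hpi hs.2⟩
  exact mul_left_cancel₀ hpi.ne'
    (injOn_circleMap_of_abs_sub_le' hR (by simp) (h_mem ha) (h_mem hb) hab)

/-- A circle, as a contour. -/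
def circleContour (c : ℂ) (R : ℝ) (hR : 0 < R) : Contour where
  toFun := circleFun c R
  closed := by simp [circleFun, circleMap]
  piecewise_C1 := ⟨{0, 1}, by simp [Set.insert_subset_iff], by simp, by simp,
    fun _ _ _ _ _ _ => (contDiff_circleFun c R).contDiffOn⟩
  simple := injOn_circleFun hR.ne'
  positive := fun w hw => by
    rw [image_circleFun hR.le, mem_sphere_iff_norm] at hw
    rcases lt_or_gt_of_ne hw with h | h
    · exact Or.inr (cauchyInt_circleFun_of_mem (mem_ball_iff_norm.2 h))
    · exact Or.inl (cauchyInt_circleFun_of_notMem hR.le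
        (by rwa [mem_closedBall_iff_norm, not_le]))

/-! ### Riesz projectors and the functional calculus -/

section FunctionalCalculus

variable {γ : Contour}

theorem Contour.avoids_iff_notMem {w : ℂ} : γ.Avoids w ↔ w ∉ γ.points := by
  have h_unit (z : ℂ) : z ∈ resolventSet ℂ w ↔ z ≠ w := by
    rw [spectrum.mem_resolventSet_iff, isUnit_iff_ne_zero, Algebra.algebraMap_self_apply,
      sub_ne_zero]
  exact ⟨fun h hw => (h_unit w).1 (h w hw) rfl,
    fun h z hz => (h_unit z).2 (ne_of_mem_of_not_mem hz h)⟩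

theorem cauchyInt_inv_sub {w : ℂ} (h : γ.Avoids w) :
    cauchyInt γ.toFun (fun z => (z - w)⁻¹) = contourInt γ (resI γ w) :=
  cauchyInt_eq_contourInt γ _ _ fun s => by
    rw [resI_apply h, resolvent, Ring.inverse_eq_inv', Algebra.algebraMap_self_apply]

theorem map_contourInt_resI {A B : Type*} [NormedRing A] [NormedAlgebra ℂ A] [CompleteSpace A]
    [NormedRing B] [NormedAlgebra ℂ B] [CompleteSpace B] (Φ : A →A[ℂ] B) {a : A}
    (h : γ.Avoids a) : Φ (contourInt γ (resI γ a)) = contourInt γ (resI γ (Φ a)) := by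
  have hΦ : γ.Avoids (Φ a) := fun z hz => by
    have := (h z hz).map Φ
    rwa [map_sub, AlgHomClass.commutes] at this
  refine (map_contourInt γ Φ.toContinuousLinearMap (resI γ a)).trans (congrArg _ ?_)
  ext s
  have h_inv : resI γ a s * (algebraMap ℂ A (γ.path s) - a) = 1 := congrArg (· s) (resI_mul h)
  have h_map := congrArg Φ h_inv
  rw [map_mul, map_sub, AlgHomClass.commutes, map_one] at h_map
  rw [resI_apply hΦ, resolvent]
  exact ((Ring.eq_mul_inverse_iff_mul_eq _ 1 _ (hΦ _ (γ.path_mem s))).2 h_map).trans (one_mul _)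

variable {A : Type*} [CStarAlgebra A] {a : A}

theorem continuousOn_contourInt_resI (h : γ.Avoids a) :
    ContinuousOn (fun w : ℂ => contourInt γ (resI γ w)) (spectrum ℂ a) := fun w hw =>
  (ContinuousAt.comp (contourInt γ).continuous.continuousAt
    (analyticAt_resI (Contour.avoids_iff_notMem.2 fun hz => hw (h w hz))).continuousAt
      ).continuousWithinAt

theorem contourInt_resI_eq_cfc (ha : IsStarNormal a) (h : γ.Avoids a) :
    contourInt γ (resI γ a) = cfc (fun w : ℂ => contourInt γ (resI γ w)) a := by
  let ι : C(spectrum ℂ a, ℂ) := (ContinuousMap.id ℂ).restrict (spectrum ℂ a)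
  have hι : γ.Avoids ι := fun z hz => by
    rw [spectrum.mem_resolventSet_iff, ContinuousMap.isUnit_iff_forall_ne_zero]
    intro w hw
    have hzw : z = w := sub_eq_zero.1 hw
    exact w.2 (hzw ▸ h z hz)
  let Φ : C(spectrum ℂ a, ℂ) →A[ℂ] A :=
    { (cfcHom ha : C(spectrum ℂ a, ℂ) →⋆ₐ[ℂ] A).toAlgHom with cont := cfcHom_continuous ha }
  have hΦ : Φ ι = a := cfcHom_id ha
  calc contourInt γ (resI γ a) = Φ (contourInt γ (resI γ ι)) := by
        rw [map_contourInt_resI Φ hι, hΦ]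
    _ = cfcHom ha ⟨_, (continuousOn_contourInt_resI h).domRestrict⟩ :=
        congrArg (cfcHom ha) (ContinuousMap.ext fun w =>
          map_contourInt_resI
            { (ContinuousMap.evalStarAlgHom ℂ ℂ w).toAlgHom with cont := continuous_eval_const w }
            hι)
    _ = cfc (fun w : ℂ => contourInt γ (resI γ w)) a :=
        (cfc_apply _ a ha (continuousOn_contourInt_resI h)).symm

theorem cauchyInt_smul_resolvent_eq_cfc (ha : IsStarNormal a) (h : γ.Avoids a) :
    cauchyInt γ.toFun (fun z => z • resolvent a z)
      = cfc (fun w : ℂ => w * contourInt γ (resI γ w)) a := by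
  rw [cauchyInt_smul_resolvent h, contourInt_zetaI_mul_resI h, contourInt_resI_eq_cfc ha h,
    cfc_mul (fun w => w) _ a continuousOn_id (continuousOn_contourInt_resI h), cfc_id' ℂ a]

theorem norm_resolvent_le {d : ℝ} (ha : IsStarNormal a) (hd : 0 < d) {z : ℂ}
    (hz : ∀ w ∈ spectrum ℂ a, d ≤ ‖z - w‖) : ‖resolvent a z‖ ≤ d⁻¹ := by
  have h_ne : ∀ w ∈ spectrum ℂ a, z - w ≠ 0 := fun w hw =>
    norm_pos_iff.1 (hd.trans_le (hz w hw))
  have h_cfc : cfc (fun w : ℂ => z - w) a = algebraMap ℂ A z - a := by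
    rw [cfc_sub (fun _ => z) (fun w => w) a, cfc_const z a, cfc_id' ℂ a]
  rw [resolvent, ← h_cfc, ← cfc_inv (fun w => z - w) a h_ne]
  refine norm_cfc_le (inv_nonneg.2 hd.le) fun w hw => ?_
  rw [norm_inv]
  exact inv_anti₀ hd (hz w hw)

theorem mem_resolventSet_of_le_norm_sub {d : ℝ} (hd : 0 < d) {z : ℂ}
    (hz : ∀ w ∈ spectrum ℂ a, d ≤ ‖z - w‖) : z ∈ resolventSet ℂ a := by
  by_contra h
  have := hz z h
  rw [sub_self, norm_zero] at this
  exact this.not_gt hd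

end FunctionalCalculus

/-! ### A circle around the negative spectrum -/

section SpectralGap

variable {E : Type*} [NormedAddCommGroup E] [InnerProductSpace ℂ E] [CompleteSpace E]
  {D : E →L[ℂ] E} {g M : ℝ}

theorem negPart_eq_cfc (hD : IsSelfAdjoint D) :
    negPart D = cfc (fun w : ℂ => ((max (-w.re) 0 : ℝ) : ℂ)) D := by
  rw [negPart, CFC.negPart_def, cfcₙ_eq_cfc, cfc_real_eq_complex _ hD]
  rfl

/-- The center of a circle of radius `M` through `-g / 2` whose interior contains `[-M, -g]`. -/
def negCenter (g M : ℝ) : ℂ := ((-(M + g / 2) : ℝ) : ℂ)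

theorem mem_spectrum_cases_of_gap (hD : IsSelfAdjoint D) (hDM : ‖D‖ ≤ M)
    (hgap : ∀ x : ℝ, x ≠ 0 → |x| < g → (x : ℂ) ∉ spectrum ℂ D) (hg : 0 < g) {w : ℂ}
    (hw : w ∈ spectrum ℂ D) :
    (w.re ≤ 0 ∧ ‖w - negCenter g M‖ ≤ M - g / 2) ∨
      (0 ≤ w.re ∧ M + g / 2 ≤ ‖w - negCenter g M‖) := by
  obtain ⟨x, rfl⟩ : ∃ x : ℝ, (x : ℂ) = w := ⟨w.re, (hD.mem_spectrum_eq_re hw).symm⟩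
  have hxM : |x| ≤ M := by
    have h_one : ‖(1 : E →L[ℂ] E)‖ ≤ 1 := ContinuousLinearMap.norm_id_le
    calc |x| = ‖(x : ℂ)‖ := (Complex.norm_real x).symm
      _ ≤ ‖D‖ * ‖(1 : E →L[ℂ] E)‖ := spectrum.norm_le_norm_mul_of_mem hw
      _ ≤ ‖D‖ := mul_le_of_le_one_right (norm_nonneg D) h_one
      _ ≤ M := hDM
  have hx_cases : x ≤ -g ∨ 0 ≤ x := by
    by_contra! hx
    exact hgap x hx.2.ne (abs_lt.2 ⟨hx.1, hx.2.trans hg⟩) hw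
  have h_norm : ‖(x : ℂ) - negCenter g M‖ = x + (M + g / 2) := by
    rw [negCenter, ← Complex.ofReal_sub, Complex.norm_real, Real.norm_eq_abs, sub_neg_eq_add,
      abs_of_nonneg (by linarith [neg_le_of_abs_le hxM])]
  rw [h_norm, Complex.ofReal_re]
  rcases hx_cases with hx | hx
  · exact Or.inl ⟨by linarith, by linarith⟩
  · exact Or.inr ⟨hx, by linarith⟩

theorem le_norm_sub_of_mem_sphere (hD : IsSelfAdjoint D) (hDM : ‖D‖ ≤ M)
    (hgap : ∀ x : ℝ, x ≠ 0 → |x| < g → (x : ℂ) ∉ spectrum ℂ D) (hg : 0 < g) {z w : ℂ}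
    (hz : z ∈ Metric.sphere (negCenter g M) M) (hw : w ∈ spectrum ℂ D) : g / 2 ≤ ‖z - w‖ := by
  rw [mem_sphere_iff_norm] at hz
  rcases mem_spectrum_cases_of_gap hD hDM hgap hg hw with ⟨-, h_near⟩ | ⟨-, h_far⟩
  · have := norm_sub_norm_le (z - negCenter g M) (w - negCenter g M)
    rw [sub_sub_sub_cancel_right] at this
    linarith
  · have := norm_sub_norm_le (w - negCenter g M) (z - negCenter g M)
    rw [sub_sub_sub_cancel_right, norm_sub_rev w z] at this
    linarith

theorem neg_negPart_eq_cauchyInt_circleContour (hD : IsSelfAdjoint D) (hDM : ‖D‖ ≤ M)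
    (hgap : ∀ x : ℝ, x ≠ 0 → |x| < g → (x : ℂ) ∉ spectrum ℂ D) (hg : 0 < g) (hM : 0 < M)
    (hav : (circleContour (negCenter g M) M hM).Avoids D) :
    -negPart D = cauchyInt (circleContour (negCenter g M) M hM).toFun
      (fun z => z • resolvent D z) := by
  rw [cauchyInt_smul_resolvent_eq_cfc hD.isStarNormal hav, negPart_eq_cfc hD, ← cfc_neg]
  refine cfc_congr fun w hw => ?_
  have hw_av : (circleContour (negCenter g M) M hM).Avoids w :=
    Contour.avoids_iff_notMem.2 fun h => hw (hav w h)
  have hw_re : w = w.re := (hD.mem_spectrum_eq_re hw)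
  simp only [← cauchyInt_inv_sub hw_av]
  rcases mem_spectrum_cases_of_gap hD hDM hgap hg hw with ⟨h_re, h_near⟩ | ⟨h_re, h_far⟩
  · have h_wind : cauchyInt (circleContour (negCenter g M) M hM).toFun (fun z => (z - w)⁻¹) = 1 :=
      cauchyInt_circleFun_of_mem (mem_ball_iff_norm.2 (by linarith))
    rw [h_wind, mul_one, max_eq_left (neg_nonneg.2 h_re), Complex.ofReal_neg, neg_neg, ← hw_re]
  · have h_wind : cauchyInt (circleContour (negCenter g M) M hM).toFun (fun z => (z - w)⁻¹) = 0 :=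
      cauchyInt_circleFun_of_notMem hM.le
        (by rw [mem_closedBall_iff_norm, not_le]; linarith)
    rw [h_wind, mul_zero, max_eq_right (neg_nonpos.2 h_re), Complex.ofReal_zero, neg_zero]

end SpectralGap

theorem exists_isAdapted {W δ τ : ℝ} (hW : 0 < W) (hδ : 0 < δ) (hτ : 0 < τ) {t : ℤ → ℝ}
    (ht : IsHomoclinic W δ t ∨ IsHeteroclinic W δ t) (htτ : ∀ n, τ ≤ t n) :
    ∃ (γ : Contour) (η : ℝ), IsAdapted t γ η := by
  obtain ⟨M, hM⟩ := exists_bound ht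
  obtain ⟨g, η, hg, hη, hgap⟩ := exists_spectral_gap hW hδ hτ ht htτ
  set R : ℝ := 2 * M + 2 * η
  have hR : 0 < R := by linarith [(abs_nonneg _).trans (hM 0)]
  let γ : Contour := circleContour (negCenter g R) R hR
  refine ⟨γ, η, hη, (g / 2)⁻¹, by positivity, fun h hh => ?_⟩
  have hD : IsSelfAdjoint (hop t + hop h) :=
    (isSelfAdjoint_hop ⟨M, hM⟩).add (isSelfAdjoint_hop ⟨η, hh⟩)
  have hDR : ‖hop t + hop h‖ ≤ R :=
    (norm_add_le _ _).trans (add_le_add (norm_hop_le hM) (norm_hop_le hh))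
  have h_dist : ∀ z ∈ γ.points, ∀ w ∈ spectrum ℂ (hop t + hop h), g / 2 ≤ ‖z - w‖ :=
    fun z hz w hw =>
      le_norm_sub_of_mem_sphere hD hDR (hgap h hh) hg ((image_circleFun hR.le).subset hz) hw
  have h_av : γ.Avoids (hop t + hop h) := fun z hz =>
    mem_resolventSet_of_le_norm_sub (half_pos hg) (h_dist z hz)
  exact ⟨fun z hz => ⟨h_av z hz, norm_resolvent_le hD.isStarNormal (half_pos hg) (h_dist z hz)⟩,
    neg_negPart_eq_cauchyInt_circleContour hD hDR (hgap h hh) hg hR h_av⟩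

end SSH

end

theorem mainTheorem3_general (μ : ℝ) {t : ℤ → ℝ} (ht : ∃ M : ℝ, ∀ n, |t n| ≤ M)
    {γ : SSH.Contour} {η : ℝ} (hA : SSH.IsAdapted t γ η) :
    (∀ h : SSH.L1, ‖h‖ ≤ η →
      SSH.IsTraceClass (SSH.negPart (SSH.hop t + SSH.hop h) - SSH.negPart (SSH.hop t))) ∧
    ContDiffOn ℝ ∞ (SSH.energyDiff μ t) (Metric.closedBall 0 η) ∧
    AnalyticOnNhd ℝ (SSH.energyDiff μ t) (Metric.ball 0 η) ∧
    ∃ (L : SSH.L1 →L[ℝ] ℝ) (B : SSH.L1 →L[ℝ] SSH.L1 →L[ℝ] ℝ),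
      (∀ h : SSH.L1, SSH.IsTraceClass (SSH.negProj (SSH.hop t) * SSH.hop h) ∧
        (L h : ℂ) = ((μ * ∑' n : ℤ, (t n - 1) * h n : ℝ) : ℂ) +
          2 * SSH.trace (SSH.negProj (SSH.hop t) * SSH.hop h)) ∧
      HasFDerivAt (SSH.energyDiff μ t) L 0 ∧
      (∀ h k : SSH.L1, SSH.IsTraceClass (SSH.hessOp t γ h k) ∧
        (B h k : ℂ) = ((μ * ∑' n : ℤ, h n * k n : ℝ) : ℂ) +
          2 * SSH.trace (SSH.hessOp t γ h k)) ∧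
      HasFDerivAt (fderiv ℝ (SSH.energyDiff μ t)) B 0 ∧
      (∃ C : ℝ, 0 ≤ C ∧ ∀ h : SSH.L1, ‖h‖ < η →
        |SSH.energyDiff μ t h - L h - 1 / 2 * B h h| ≤ C * ‖SSH.toL2 h‖ ^ 3) ∧
      ∃ B₂ : SSH.L2 →L[ℝ] SSH.L2 →L[ℝ] ℝ,
        ∀ h k : SSH.L1, B₂ (SSH.toL2 h) (SSH.toL2 k) = B h k := by
  obtain ⟨M, hM⟩ := ht
  have hb : ∀ n, ‖t n - 1‖ ≤ M + 1 := fun n =>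
    (norm_sub_le _ _).trans (add_le_add (hM n) norm_one.le)
  have h_zero : ‖(0 : SSH.L1)‖ < η := norm_zero.trans_lt hA.1
  have h_slope (h : SSH.L1) : SSH.IsTraceClass (SSH.negProj (SSH.hop t) * SSH.hop h) := by
    simpa only [mul_one] using SSH.isTraceClass_mul_hop_mul h (SSH.negProj (SSH.hop t)) 1
  refine ⟨fun h hh => hA.isTraceClass hh, hA.contDiffOn_energyDiff hb,
    hA.analyticOnNhd_energyDiff hb, SSH.energyDeriv μ γ hb 0, SSH.energyHess μ t γ,
    fun h => ⟨h_slope h, ?_⟩, hA.hasFDerivAt_energyDiff hb h_zero,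
    fun h k => ⟨hA.isTraceClass_hessOp h k, hA.ofReal_energyHess h k⟩,
    hA.hasFDerivAt_fderiv_energyDiff hb, ?_, ?_⟩
  · rw [hA.ofReal_energyDeriv_zero hb, hA.slope_zero_eq ⟨M, hM⟩]
  · obtain ⟨C, hC, h_rem⟩ := hA.exists_taylor_remainder_le hb
    exact ⟨C, hC, fun h hh => h_rem h hh.le⟩
  · have h_len := γ.len_nonneg
    exact SSH.exists_bilinear_extension SSH.denseRange_toL2L _ (by positivity)
      SSH.norm_energyHess_le

theorem mainTheorem3 (μ W δ τ : ℝ) (hμ : 0 < μ) (hW : 0 < W) (hδ : 0 < δ) (hτ : 0 < τ)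
    (t : ℤ → ℝ) (ht : SSH.IsHomoclinic W δ t ∨ SSH.IsHeteroclinic W δ t)
    (htτ : ∀ n, τ ≤ t n) :
    (∃ (γ : SSH.Contour) (η : ℝ), SSH.IsAdapted t γ η) ∧
    ∀ (γ : SSH.Contour) (η : ℝ), SSH.IsAdapted t γ η →
      -- `F_t` is well defined, smooth and analytic
      (∀ h : SSH.L1, ‖h‖ ≤ η →
        SSH.IsTraceClass (SSH.negPart (SSH.hop t + SSH.hop h) - SSH.negPart (SSH.hop t))) ∧
      ContDiffOn ℝ ∞ (SSH.energyDiff μ t) (Metric.closedBall 0 η) ∧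
      AnalyticOnNhd ℝ (SSH.energyDiff μ t) (Metric.ball 0 η) ∧
      ∃ (L : SSH.L1 →L[ℝ] ℝ) (B : SSH.L1 →L[ℝ] SSH.L1 →L[ℝ] ℝ),
        -- the differential
        (∀ h : SSH.L1, SSH.IsTraceClass (SSH.negProj (SSH.hop t) * SSH.hop h) ∧
          (L h : ℂ) = ((μ * ∑' n : ℤ, (t n - 1) * h n : ℝ) : ℂ) +
            2 * SSH.trace (SSH.negProj (SSH.hop t) * SSH.hop h)) ∧
        HasFDerivAt (SSH.energyDiff μ t) L 0 ∧
        -- the Hessian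
        (∀ h k : SSH.L1, SSH.IsTraceClass (SSH.hessOp t γ h k) ∧
          (B h k : ℂ) = ((μ * ∑' n : ℤ, h n * k n : ℝ) : ℂ) +
            2 * SSH.trace (SSH.hessOp t γ h k)) ∧
        HasFDerivAt (fderiv ℝ (SSH.energyDiff μ t)) B 0 ∧
        -- the Taylor remainder
        (∃ C : ℝ, 0 ≤ C ∧ ∀ h : SSH.L1, ‖h‖ < η →
          |SSH.energyDiff μ t h - L h - 1 / 2 * B h h| ≤ C * ‖SSH.toL2 h‖ ^ 3) ∧
        -- continuous extension of the Hessian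
        ∃ B₂ : SSH.L2 →L[ℝ] SSH.L2 →L[ℝ] ℝ,
          ∀ h k : SSH.L1, B₂ (SSH.toL2 h) (SSH.toL2 k) = B h k :=
  ⟨SSH.exists_isAdapted hW hδ hτ ht htτ, fun _ _ hA =>
    mainTheorem3_general μ (SSH.exists_bound ht) hA⟩
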